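/- Let $A\in\mathbb{R}^{n\times n}$ be symmetric positive semidefinite with eigenvalues $\lambda_1\ge\lambda_2\ge\dots\ge\lambda_n\ge 0$ (and $\lambda_i:=0$ for $i>n$). Let $k\ge 1$, $p\ge 2$ and $q\ge 1$ be integers, and let $\gamma=\lambda_{k+1}/\lambda_k$ (with $\gamma:=0$ if $\lambda_k=0$). Let $\Omega$ be an $n\times(k+p)$ random matrix whose entries are independent $N(0,1)$ random variables, let $Q$ be a matrix whose columns form an orthonormal basis of $\operatorname{range}(A^{q-1}\Omega)$ (where $A^0=I$), and let $$\widehat{A}=AQ\,(Q^TAQ)^{\dagger}\,Q^TA$$ be the corresponding Nyström approximation, where $\dagger$ denotes the Moore–Penrose pseudoinverse. Let $f:[0,\infty)\to[0,\infty)$ be continuous and operator monotone, i.e. for all symmetric matrices $B,C$ of equal size such that $C$ and $B-C$ are positive semidefinite, $f(B)-f(C)$ is positive semidefinite; here $f(U\operatorname{diag}(\mu_i)U^T)=U\operatorname{diag}(f(\mu_i))U^T$ for orthogonal $U$. For a square matrix $B$ let $B_{(k)}$ denote a best rank-$k$ approximation obtained by truncating a singular value decomposition of $B$ to its $k$ largest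 singular values (any choice is allowed when singular values are tied, and $B_{(k)}=B$ if $k\ge n$), and let $\|B\|_*$ be the nuclear norm, the sum of the singular values of $B$. Then $\|f(A)-f(\widehat{A})_{(k)}\|_*$ is an integrable random variable and $$\mathbb{E}\,\|f(A)-f(\widehat{A})_{(k)}\|_*\;\le\;\Bigl(1+\gamma^{2(q-1)}\,\frac{k}{p-1}\Bigr)\,\|f(A)-f(A)_{(k)}\|_*,$$ where $\gamma^0=1$. -/

import Mathlib

open MeasureTheory ProbabilityTheory

namespace FunNystrom

/-- The `i`-th largest eigenvalue `λ_i` of a real symmetric matrix, counted with multiplicity and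
numbered from `1`; it is `0` for indices outside `{1, …, n}`. -/
noncomputable def sortedEigenvalue {n : ℕ} {A : Matrix (Fin n) (Fin n) ℝ} (hA : A.IsHermitian)
    (i : ℕ) : ℝ :=
  if h : 1 ≤ i ∧ i ≤ n then
    hA.eigenvalues₀ ⟨i - 1, by rw [Fintype.card_fin]; omega⟩
  else 0

/-- The nuclear norm: the sum of the singular values (Mathlib numbers them from `0`). -/
noncomputable def nuclearNorm {m n : ℕ} (M : Matrix (Fin m) (Fin n) ℝ) : ℝ :=
  ∑ i ∈ Finset.range n, (Matrix.toEuclideanLin M).singularValues i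

/-- `X` is a rank-`k` truncated singular value decomposition of the square matrix `B`: for some
singular value decomposition `B = U diag(s₁ ≥ s₂ ≥ … ≥ 0) Vᵀ`, only the `k` leading singular values
are kept. (When singular values are tied there can be several such `X`.) -/
def IsTruncatedSVD {n : ℕ} (k : ℕ) (B X : Matrix (Fin n) (Fin n) ℝ) : Prop :=
  ∃ U ∈ Matrix.orthogonalGroup (Fin n) ℝ, ∃ V ∈ Matrix.orthogonalGroup (Fin n) ℝ,
    ∃ s : Fin n → ℝ, Antitone s ∧ (∀ i, 0 ≤ s i) ∧
      B = U * Matrix.diagonal s * V.transpose ∧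
      X = U * Matrix.diagonal (fun i : Fin n => if (i : ℕ) < k then s i else 0) * V.transpose

/-- The Moore-Penrose pseudoinverse `M† = (MᵀM)† Mᵀ`, where `(MᵀM)†` inverts the nonzero
eigenvalues of `MᵀM` and keeps the zero ones (`0⁻¹ = 0` in `ℝ`). -/
noncomputable def pinv {m n : ℕ} (M : Matrix (Fin m) (Fin n) ℝ) : Matrix (Fin n) (Fin m) ℝ :=
  cfc (fun x : ℝ => x⁻¹) (M.transpose * M) * M.transpose

/-- `pinv M` satisfies the four Penrose equations, which characterize the pseudoinverse. -/
theorem pinv_penrose {m n : ℕ} (M : Matrix (Fin m) (Fin n) ℝ) :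
    M * pinv M * M = M ∧ pinv M * M * pinv M = pinv M ∧
      (M * pinv M).transpose = M * pinv M ∧ (pinv M * M).transpose = pinv M * M := by
  set S := M.transpose * M with hSdef
  set G := cfc (fun x : ℝ => x⁻¹) S with hGdef
  have hS : IsSelfAdjoint S := Matrix.isHermitian_conjTranspose_mul_self M
  have hc : ∀ g : ℝ → ℝ, ContinuousOn g (spectrum ℝ S) := fun g =>
    (Matrix.finite_real_spectrum (A := S)).continuousOn g
  have hST : S.transpose = S := hS
  have hGT : G.transpose = G := (cfc_predicate (fun x : ℝ => x⁻¹) S : IsSelfAdjoint _)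
  have hid : cfc (id : ℝ → ℝ) S = S := cfc_id ℝ S
  have hGS : G * S = S * G := by
    have h : cfc (fun x : ℝ => x⁻¹) S * cfc (id : ℝ → ℝ) S
        = cfc (id : ℝ → ℝ) S * cfc (fun x : ℝ => x⁻¹) S :=
      (cfc_commute_cfc (fun x : ℝ => x⁻¹) (id : ℝ → ℝ) S).eq
    rwa [hid] at h
  have hSGS : S * G * S = S := by
    have h : cfc (id : ℝ → ℝ) S * cfc (fun x : ℝ => x⁻¹) S * cfc (id : ℝ → ℝ) S = cfc (id : ℝ → ℝ) S := by
      rw [← cfc_mul _ _ S (hc _) (hc _), ← cfc_mul _ _ S (hc _) (hc _)]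
      congr 1
      funext x
      exact mul_inv_mul_cancel x
    rwa [hid] at h
  have hGSG : G * S * G = G := by
    have h : cfc (fun x : ℝ => x⁻¹) S * cfc (id : ℝ → ℝ) S * cfc (fun x : ℝ => x⁻¹) S
        = cfc (fun x : ℝ => x⁻¹) S := by
      rw [← cfc_mul _ _ S (hc _) (hc _), ← cfc_mul _ _ S (hc _) (hc _)]
      congr 1
      funext x
      simpa using mul_inv_mul_cancel x⁻¹
    rwa [hid] at h
  have hP : pinv M = G * M.transpose := rfl
  have hPM : pinv M * M = G * S := by rw [hP, Matrix.mul_assoc]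
  have hMGS : M * (G * S) = M := by
    have h0 : (M * (G * S) - M).transpose * (M * (G * S) - M) = 0 := by
      have : (M * (G * S) - M).transpose * (M * (G * S) - M)
          = (S * G) * S * (G * S) - (S * G) * S - S * (G * S) + S := by
        simp only [Matrix.transpose_sub, Matrix.transpose_mul, hGT, Matrix.sub_mul,
          Matrix.mul_sub, hSdef, Matrix.transpose_transpose, Matrix.mul_assoc]
        abel
      rw [this, hSGS, ← Matrix.mul_assoc, hSGS]
      abel
    have h1 : M * (G * S) - M = 0 := by
      apply Matrix.conjTranspose_mul_self_eq_zero.mp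
      simpa [Matrix.conjTranspose_eq_transpose_of_trivial] using h0
    exact sub_eq_zero.mp h1
  refine ⟨?_, ?_, ?_, ?_⟩
  · rw [Matrix.mul_assoc, hPM, hMGS]
  · rw [hPM, hP, ← Matrix.mul_assoc, hGSG]
  · rw [hP, Matrix.transpose_mul, Matrix.transpose_mul, hGT, Matrix.transpose_transpose,
      Matrix.mul_assoc]
  · rw [hPM, Matrix.transpose_mul, hGT, hST, hGS]

/-- The Nyström approximation `A Q (Qᵀ A Q)† Qᵀ A`. -/
noncomputable def nystrom {n r : ℕ} (A : Matrix (Fin n) (Fin n) ℝ) (Q : Matrix (Fin n) (Fin r) ℝ) :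
    Matrix (Fin n) (Fin n) ℝ :=
  A * Q * pinv (Q.transpose * A * Q) * Q.transpose * A

/-- The columns of `Q` form an orthonormal basis of the range (column space) of `M`. -/
def IsOrthonormalBasisOfRange {n r l : ℕ} (Q : Matrix (Fin n) (Fin r) ℝ)
    (M : Matrix (Fin n) (Fin l) ℝ) : Prop :=
  Q.transpose * Q = 1 ∧ LinearMap.range Q.mulVecLin = LinearMap.range M.mulVecLin

/-- A real function on `[0, ∞)` is operator monotone: `B ⪰ C ⪰ 0` implies `f(B) ⪰ f(C)` for
symmetric matrices `B`, `C` of every size. Matrix functions are given by the functional calculus,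
that is, `f(U diag(λ) Uᵀ) = U diag(f(λ)) Uᵀ`; only the values of `f` on `[0, ∞)` matter. -/
def OperatorMonotone (f : ℝ → ℝ) : Prop :=
  ∀ (n : ℕ) (B C : Matrix (Fin n) (Fin n) ℝ),
    C.PosSemidef → (B - C).PosSemidef → (cfc f B - cfc f C).PosSemidef

end FunNystrom

/-! Write A = U diag(a) Uᵀ with a decreasing, B = A^(1/2) and s = q - 1. The Nyström matrix is Â = B
E B, where E is the orthogonal projection onto the range of B A^s Ω (`exists_projection_nystrom`),
so 0 ⪯ Â ⪯ A. Operator monotonicity gives f(Â) ⪯ f(A); hence f(A) - f(Â)_(k) is positive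
semidefinite and its nuclear norm is a difference of traces. The norm on the right is the tail τ =
Σ_{i>k} f(λ_i). What remains is a lower bound for tr f(Â)_(k), the sum of the k largest eigenvalues
of f(Â).

Suppose λ_k > 0. Let R be a right inverse of the top k rows Ω₁ of UᵀΩ, so that G = UᵀΩR is the
identity stacked on Ω₂Ω₁†. Rescaling by powers of eigenvalues turns G into T (`ritzCoordinates`),
which keeps the identity block and satisfies range(UT) ⊆ range(E). Choose V = TL with VᵀV = 1 and Vᵀ
diag(a) V = diag(μ) (`exists_ritz_basis`). Then B (UV)(UV)ᵀ B ⪯ Â has nonzero eigenvalues μ_j, so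
monotonicity and Ky Fan's inequality give tr f(Â)_(k) ≥ Σ f(μ_j). An operator monotone f is concave
(`OperatorMonotone.concaveOn`), so Jensen gives f(μ_j) ≥ Σ_i V_ij² f(λ_i). With (TᵀT)⁻¹ ⪰ 2 - TᵀT
(`one_sub_le_row_sum_sq`) this leaves Σ_j f(λ_j)(1 - Σ_{i>k} T_ij²), and concavity turns the loss
into at most γ^(2s) Σ_{i>k} Σ_j f(λ_i) G_ij² (`sum_leading_le_trace_add`).

Row i > k of UᵀΩ is independent of Ω₁, so E G_ij² is the mean of the j-th diagonal entry of
(Ω₁Ω₁ᵀ)⁻¹. That entry is at most the inverse of a chi-squared variable with p + 1 degrees of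
freedom, whose mean is 1/(p - 1). Summing over the k columns gives the bound. If fewer than k
eigenvalues are positive (or k > n), then Â = A almost surely and the error is exactly τ.

Measurability needs an argument because the truncation is an arbitrary choice: its trace is
nevertheless determined by Ω, through the variational formula of Ky Fan. -/

namespace FunNystrom

open Matrix

/-! ### Orthogonal diagonalization, nuclear norm and truncation of semidefinite matrices. -/

section Spectral

variable {n : ℕ}

theorem transpose_mul_self_of_mem {U : Matrix (Fin n) (Fin n) ℝ}
    (hU : U ∈ orthogonalGroup (Fin n) ℝ) : Uᵀ * U = 1 := by
  have := (mem_orthogonalGroup_iff' (Fin n) ℝ).1 hU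
  simpa [star_eq_conjTranspose] using this

theorem mul_transpose_self_of_mem {U : Matrix (Fin n) (Fin n) ℝ}
    (hU : U ∈ orthogonalGroup (Fin n) ℝ) : U * Uᵀ = 1 := by
  have := (mem_orthogonalGroup_iff (Fin n) ℝ).1 hU
  simpa [star_eq_conjTranspose] using this

theorem mem_orthogonalGroup_of_transpose_mul {U : Matrix (Fin n) (Fin n) ℝ}
    (h : Uᵀ * U = 1) : U ∈ orthogonalGroup (Fin n) ℝ :=
  (mem_orthogonalGroup_iff' (Fin n) ℝ).2 (by simpa [star_eq_conjTranspose] using h)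

/-- Two orthogonal diagonalizations of a matrix define the same matrix functions. -/
theorem conj_diagonal_congr {U V : Matrix (Fin n) (Fin n) ℝ} {a b : Fin n → ℝ}
    (hU : U ∈ orthogonalGroup (Fin n) ℝ) (hV : V ∈ orthogonalGroup (Fin n) ℝ)
    (h : U * diagonal a * Uᵀ = V * diagonal b * Vᵀ) (g : ℝ → ℝ) :
    U * diagonal (fun i => g (a i)) * Uᵀ = V * diagonal (fun i => g (b i)) * Vᵀ := by
  have hU1 := transpose_mul_self_of_mem hU
  have hU2 := mul_transpose_self_of_mem hU
  have hV1 := transpose_mul_self_of_mem hV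
  have hV2 := mul_transpose_self_of_mem hV
  -- `T` intertwines the two diagonal matrices, so `T i j` can be nonzero only where `a i = b j`;
  -- hence it also intertwines their images under `g`.
  set T := Uᵀ * V with hT
  have h1 : diagonal a * T = T * diagonal b := by
    calc diagonal a * T = (Uᵀ * U) * diagonal a * Uᵀ * V := by rw [hU1, hT]; simp [Matrix.mul_assoc]
      _ = Uᵀ * (U * diagonal a * Uᵀ) * V := by simp only [Matrix.mul_assoc]
      _ = Uᵀ * V * diagonal b * (Vᵀ * V) := by rw [h]; simp only [Matrix.mul_assoc]
      _ = T * diagonal b := by rw [hV1, Matrix.mul_one]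
  have h2 : diagonal (fun i => g (a i)) * T = T * diagonal (fun i => g (b i)) := by
    ext i j
    have := congrFun (congrFun h1 i) j
    simp only [diagonal_mul, mul_diagonal] at this ⊢
    by_cases hij : T i j = 0
    · simp [hij]
    · have : a i = b j := by
        rw [mul_comm] at this
        exact mul_left_cancel₀ hij this
      rw [this, mul_comm]
  calc U * diagonal (fun i => g (a i)) * Uᵀ
      = U * (diagonal (fun i => g (a i)) * T) * Vᵀ := by
        rw [hT]
        simp only [Matrix.mul_assoc, hV2, Matrix.mul_one]
    _ = (U * Uᵀ) * V * diagonal (fun i => g (b i)) * Vᵀ := by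
        rw [h2, hT]; simp only [Matrix.mul_assoc]
    _ = _ := by rw [hU2, Matrix.one_mul]

theorem exists_orthogonal_eigenvalues {A : Matrix (Fin n) (Fin n) ℝ} (hA : A.IsHermitian) :
    ∃ U ∈ orthogonalGroup (Fin n) ℝ, A = U * diagonal hA.eigenvalues * Uᵀ ∧
      ∀ g : ℝ → ℝ, cfc g A = U * diagonal (fun i => g (hA.eigenvalues i)) * Uᵀ := by
  refine ⟨hA.eigenvectorUnitary, hA.eigenvectorUnitary.2, ?_, fun g => ?_⟩
  · conv_lhs => rw [hA.spectral_theorem]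
    rfl
  · rw [hA.cfc_eq]
    rfl

theorem cfc_conj_diagonal {U : Matrix (Fin n) (Fin n) ℝ} (hU : U ∈ orthogonalGroup (Fin n) ℝ)
    (a : Fin n → ℝ) (g : ℝ → ℝ) :
    cfc g (U * diagonal a * Uᵀ) = U * diagonal (fun i => g (a i)) * Uᵀ := by
  have hA : (U * diagonal a * Uᵀ).IsHermitian := by
    simp [IsHermitian, conjTranspose_eq_transpose_of_trivial, Matrix.mul_assoc]
  obtain ⟨V, hV, h1, h2⟩ := exists_orthogonal_eigenvalues hA
  rw [h2]
  exact (conj_diagonal_congr hU hV h1 g).symm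

/-- Orthogonal diagonalization with the eigenvalues in decreasing order. -/
theorem exists_orthogonal_sortedEigenvalue {A : Matrix (Fin n) (Fin n) ℝ} (hA : A.IsHermitian) :
    ∃ U ∈ orthogonalGroup (Fin n) ℝ, ∃ a : Fin n → ℝ, Antitone a ∧ A = U * diagonal a * Uᵀ ∧
      ∀ i : Fin n, sortedEigenvalue hA (i + 1) = a i := by
  obtain ⟨U, hU, hA', -⟩ := exists_orthogonal_eigenvalues hA
  have hc : n = Fintype.card (Fin n) := (Fintype.card_fin n).symm
  set e := (Fintype.equivOfCardEq (Fintype.card_fin (Fintype.card (Fin n))) :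
    Fin (Fintype.card (Fin n)) ≃ Fin n) with he
  set σ : Fin n ≃ Fin n := (finCongr hc).trans e with hσ
  have ha : ∀ i, hA.eigenvalues (σ i) = hA.eigenvalues₀ (Fin.cast hc i) := by
    intro i
    simp only [IsHermitian.eigenvalues, hσ, Equiv.trans_apply, finCongr_apply]
    congr 1
    exact e.symm_apply_apply _
  have hU1 := transpose_mul_self_of_mem hU
  refine ⟨U.submatrix id σ, mem_orthogonalGroup_of_transpose_mul ?_,
    fun i => hA.eigenvalues (σ i), ?_, ?_, ?_⟩
  · have : (U.submatrix id σ)ᵀ * U.submatrix id σ = (Uᵀ * U).submatrix σ σ := by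
      ext i j
      simp [Matrix.mul_apply]
    rw [this, hU1]
    simp
  · intro i j hij
    simp only [ha]
    exact hA.eigenvalues₀_antitone hij
  · conv_lhs => rw [hA']
    ext i j
    rw [Matrix.mul_apply, Matrix.mul_apply]
    simp only [mul_diagonal, transpose_apply, submatrix_apply, id]
    exact (Equiv.sum_comp σ (fun x => U i x * hA.eigenvalues x * U j x)).symm
  · intro i
    have hi : 1 ≤ (i : ℕ) + 1 ∧ (i : ℕ) + 1 ≤ n := ⟨by omega, i.2⟩
    simp only [sortedEigenvalue, hi, and_self, dif_pos, ha]
    rfl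

theorem trace_conj {U : Matrix (Fin n) (Fin n) ℝ} (hU : U ∈ orthogonalGroup (Fin n) ℝ)
    (D : Matrix (Fin n) (Fin n) ℝ) : (U * D * Uᵀ).trace = D.trace := by
  rw [Matrix.trace_mul_comm, ← Matrix.mul_assoc, transpose_mul_self_of_mem hU, Matrix.one_mul]

theorem posSemidef_conj_diagonal (U : Matrix (Fin n) (Fin n) ℝ) {a : Fin n → ℝ}
    (ha : ∀ i, 0 ≤ a i) : (U * diagonal a * Uᵀ).PosSemidef := by
  have := (PosSemidef.diagonal (d := a) ha).mul_mul_conjTranspose_same U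
  simpa using this

theorem nonneg_of_posSemidef_conj_diagonal {U : Matrix (Fin n) (Fin n) ℝ} {a : Fin n → ℝ}
    (hU : U ∈ orthogonalGroup (Fin n) ℝ) (h : (U * diagonal a * Uᵀ).PosSemidef) (i : Fin n) :
    0 ≤ a i := by
  have h1 := h.mul_mul_conjTranspose_same Uᵀ
  have h2 : Uᵀ * (U * diagonal a * Uᵀ) * Uᵀᴴ = diagonal a := by
    have := transpose_mul_self_of_mem hU
    calc _ = (Uᵀ * U) * diagonal a * (Uᵀ * U) := by simp [Matrix.mul_assoc]
      _ = _ := by simp [this]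
  rw [h2] at h1
  simpa using h1.diag_nonneg (i := i)

/-- Positive semidefinite square roots are unique, in terms of diagonalizations. -/
theorem PosSemidef.eq_of_mul_self {B C : Matrix (Fin n) (Fin n) ℝ} (hB : B.PosSemidef)
    (hC : C.PosSemidef) (h : B * B = C * C) : B = C := by
  obtain ⟨U, hU, a, -, hB', -⟩ := exists_orthogonal_sortedEigenvalue hB.isHermitian
  obtain ⟨V, hV, b, -, hC', -⟩ := exists_orthogonal_sortedEigenvalue hC.isHermitian
  have ha := nonneg_of_posSemidef_conj_diagonal hU (hB' ▸ hB)
  have hb := nonneg_of_posSemidef_conj_diagonal hV (hC' ▸ hC)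
  have sq : ∀ {U : Matrix (Fin n) (Fin n) ℝ} (_ : U ∈ orthogonalGroup (Fin n) ℝ) (a : Fin n → ℝ),
      (U * diagonal a * Uᵀ) * (U * diagonal a * Uᵀ) = U * diagonal (fun i => a i * a i) * Uᵀ := by
    intro U hU a
    calc _ = U * diagonal a * (Uᵀ * U) * diagonal a * Uᵀ := by simp only [Matrix.mul_assoc]
      _ = U * (diagonal a * diagonal a) * Uᵀ := by
        rw [transpose_mul_self_of_mem hU]; simp only [Matrix.mul_one, Matrix.mul_assoc]
      _ = _ := by rw [diagonal_mul_diagonal]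
  rw [hB', hC', sq hU, sq hV] at h
  have := conj_diagonal_congr hU hV h Real.sqrt
  simp only [Real.sqrt_mul_self, ha, hb] at this
  rw [hB', hC', this]

/-- The singular values are the square roots of the eigenvalues of MᵀM, and by uniqueness of the
positive semidefinite root `M` is the matrix with these roots as eigenvalues. -/
theorem nuclearNorm_eq_trace {M : Matrix (Fin n) (Fin n) ℝ} (hM : M.PosSemidef) :
    nuclearNorm M = M.trace := by
  have hS : (Mᵀ * M).IsHermitian := by
    simpa [conjTranspose_eq_transpose_of_trivial] using isHermitian_conjTranspose_mul_self M
  have hadj : LinearMap.adjoint (toEuclideanLin M) ∘ₗ toEuclideanLin M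
      = toEuclideanLin (Mᵀ * M) := by
    have := Matrix.toEuclideanLin_conjTranspose_eq_adjoint M
    rw [conjTranspose_eq_transpose_of_trivial] at this
    rw [← this]
    ext x i
    simp
  have key : ∀ (T : EuclideanSpace ℝ (Fin n) →ₗ[ℝ] EuclideanSpace ℝ (Fin n)) (h : T.IsSymmetric)
      (_ : T = toEuclideanLin (Mᵀ * M)) (N : ℕ) (hN : Module.finrank ℝ (EuclideanSpace ℝ (Fin n)) = N)
      (hN' : N = Fintype.card (Fin n)) (i : Fin N),
      h.eigenvalues hN i = hS.eigenvalues₀ (Fin.cast hN' i) := by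
    intro T h hT N hN hN' i
    subst hT
    subst hN'
    rfl
  have h1 : ∀ i : Fin n, (toEuclideanLin M).singularValues i
      = √(hS.eigenvalues₀ (Fin.cast (Fintype.card_fin n).symm i)) := by
    intro i
    rw [LinearMap.singularValues_fin (n := n) _ (by simp)]
    rw [key _ _ hadj n (by simp) (by simp) i]
  have h2 : nuclearNorm M = ∑ i, √(hS.eigenvalues i) := by
    rw [nuclearNorm, Finset.sum_range]
    simp_rw [h1, IsHermitian.eigenvalues]
    rw [Equiv.sum_comp (Fintype.equivOfCardEq (Fintype.card_fin (Fintype.card (Fin n)))).symm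
      (fun i => √(hS.eigenvalues₀ i))]
    exact Equiv.sum_comp (finCongr (Fintype.card_fin n).symm) (fun i => √(hS.eigenvalues₀ i))
  obtain ⟨U, hU, hS', -⟩ := exists_orthogonal_eigenvalues hS
  have hpos : (Mᵀ * M).PosSemidef := by
    simpa [conjTranspose_eq_transpose_of_trivial] using posSemidef_conjTranspose_mul_self M
  have h0 := hpos.eigenvalues_nonneg
  have h3 : M = U * diagonal (fun i => √(hS.eigenvalues i)) * Uᵀ := by
    refine PosSemidef.eq_of_mul_self hM (posSemidef_conj_diagonal U fun i => Real.sqrt_nonneg _) ?_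
    have hMT : Mᵀ = M := by
      simpa [IsHermitian, conjTranspose_eq_transpose_of_trivial] using hM.isHermitian
    calc M * M = Mᵀ * M := by rw [hMT]
      _ = U * diagonal hS.eigenvalues * Uᵀ := hS'
      _ = U * (diagonal (fun i => √(hS.eigenvalues i)) * diagonal (fun i => √(hS.eigenvalues i)))
          * Uᵀ := by
        rw [diagonal_mul_diagonal]
        congr 3
        ext i
        exact (Real.mul_self_sqrt (h0 i)).symm
      _ = U * diagonal (fun i => √(hS.eigenvalues i)) * (Uᵀ * U)
          * diagonal (fun i => √(hS.eigenvalues i)) * Uᵀ := by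
        rw [transpose_mul_self_of_mem hU]; simp only [Matrix.mul_one, Matrix.mul_assoc]
      _ = _ := by simp only [Matrix.mul_assoc]
  rw [h2]
  conv_rhs => rw [h3]
  rw [trace_conj hU, trace_diagonal]

/-- A truncated singular value decomposition of a positive semidefinite matrix is a truncated
orthogonal diagonalization. -/
theorem IsTruncatedSVD.exists_diagonalization {k : ℕ} {B X : Matrix (Fin n) (Fin n) ℝ}
    (hB : B.PosSemidef) (h : IsTruncatedSVD k B X) :
    ∃ U ∈ orthogonalGroup (Fin n) ℝ, ∃ s : Fin n → ℝ, Antitone s ∧ (∀ i, 0 ≤ s i) ∧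
      B = U * diagonal s * Uᵀ ∧
      X = U * diagonal (fun i : Fin n => if (i : ℕ) < k then s i else 0) * Uᵀ := by
  obtain ⟨U, hU, V, hV, s, hs, hs0, hBs, hXs⟩ := h
  have hU1 := transpose_mul_self_of_mem hU
  have hV1 := transpose_mul_self_of_mem hV
  have hBT : Bᵀ = B := by
    simpa [IsHermitian, conjTranspose_eq_transpose_of_trivial] using hB.isHermitian
  have hH : B = U * diagonal s * Uᵀ := by
    refine PosSemidef.eq_of_mul_self hB (posSemidef_conj_diagonal U hs0) ?_
    calc B * B = B * Bᵀ := by rw [hBT]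
      _ = U * diagonal s * (Vᵀ * V) * diagonal s * Uᵀ := by
        rw [hBs]
        simp only [transpose_mul, diagonal_transpose, transpose_transpose, Matrix.mul_assoc]
      _ = U * diagonal s * (Uᵀ * U) * diagonal s * Uᵀ := by rw [hV1, hU1]
      _ = _ := by simp only [Matrix.mul_assoc]
  refine ⟨U, hU, s, hs, hs0, hH, ?_⟩
  -- `V` may differ from `U` on the kernel of `B`, but only the product with `diagonal s` enters the
  -- truncation.
  have hsV : diagonal s * Vᵀ = diagonal s * Uᵀ := by
    have h1 : U * (diagonal s * Vᵀ) = U * (diagonal s * Uᵀ) := by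
      rw [← Matrix.mul_assoc, ← Matrix.mul_assoc, ← hBs, ← hH]
    calc diagonal s * Vᵀ = Uᵀ * (U * (diagonal s * Vᵀ)) := by
          rw [← Matrix.mul_assoc, hU1, Matrix.one_mul]
      _ = diagonal s * Uᵀ := by rw [h1, ← Matrix.mul_assoc, hU1, Matrix.one_mul]
  have hd : (diagonal (fun i : Fin n => if (i : ℕ) < k then s i else 0) : Matrix _ _ ℝ)
      = diagonal (fun i : Fin n => if (i : ℕ) < k then 1 else 0) * diagonal s := by
    rw [diagonal_mul_diagonal]
    congr 1
    ext i
    split_ifs <;> simp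
  rw [hXs, hd]
  simp only [Matrix.mul_assoc, hsV]

end Spectral

/-! ### Ky Fan's variational principle for the sum of the k largest eigenvalues. -/

section KyFan

variable {n : ℕ}

/-- Moving weight to the leading indices can only help: compare every term with the threshold value
`s k`, which is at most the leading values and at least the others. -/
theorem sum_mul_le_sum_leading {k : ℕ} {s c : Fin n → ℝ} (hs : Antitone s) (hs0 : ∀ i, 0 ≤ s i)
    (hc0 : ∀ i, 0 ≤ c i) (hc1 : ∀ i, c i ≤ 1) (hck : ∑ i, c i ≤ k) :
    ∑ i, c i * s i ≤ ∑ i : Fin n, if (i : ℕ) < k then s i else 0 := by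
  by_cases hkn : n ≤ k
  · refine Finset.sum_le_sum fun i _ => ?_
    rw [if_pos (i.2.trans_le hkn)]
    exact mul_le_of_le_one_left (hs0 i) (hc1 i)
  · push Not at hkn
    set t := s ⟨k, hkn⟩ with ht
    have ht0 : 0 ≤ t := hs0 _
    have hcount : ∑ i : Fin n, (if (i : ℕ) < k then (1 : ℝ) else 0) = k := by
      rw [Finset.sum_boole]
      have : (Finset.univ.filter fun i : Fin n => (i : ℕ) < k) = Finset.Iio ⟨k, hkn⟩ := by
        ext i; simp [Fin.lt_def]
      rw [this, Fin.card_Iio]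
    have h1 : ∀ i : Fin n, c i * s i + ((if (i : ℕ) < k then (1 : ℝ) else 0) - c i) * t
        ≤ if (i : ℕ) < k then s i else 0 := by
      intro i
      split_ifs with h
      · have : t ≤ s i := hs (show i ≤ ⟨k, hkn⟩ from h.le)
        nlinarith [hc1 i]
      · have : s i ≤ t := hs (show (⟨k, hkn⟩ : Fin n) ≤ i from not_lt.1 h)
        nlinarith [hc0 i]
    have h2 := Finset.sum_le_sum fun i (_ : i ∈ Finset.univ) => h1 i
    rw [Finset.sum_add_distrib, ← Finset.sum_mul, Finset.sum_sub_distrib, hcount] at h2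
    nlinarith [mul_nonneg (sub_nonneg.2 hck) ht0]

/-- N Nᵀ is an orthogonal projection, so a diagonal entry `d` of it satisfies d² ≤ d. -/
theorem row_sum_sq_le_one {m : ℕ} {N : Matrix (Fin n) (Fin m) ℝ} (hN : Nᵀ * N = 1) (i : Fin n) :
    ∑ j, N i j ^ 2 ≤ 1 := by
  set d := (N * Nᵀ) i i with hd
  have h0 : ∑ j, N i j ^ 2 = d := by simp [hd, Matrix.mul_apply, sq]
  have h1 : (N * Nᵀ) * (N * Nᵀ) = N * Nᵀ := by
    calc _ = N * (Nᵀ * N) * Nᵀ := by simp only [Matrix.mul_assoc]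
      _ = _ := by rw [hN, Matrix.mul_one]
  have h2 : ∑ l, (N * Nᵀ) i l * (N * Nᵀ) l i = d := by
    rw [← Matrix.mul_apply, h1]
  have h3 : d * d ≤ ∑ l, (N * Nᵀ) i l * (N * Nᵀ) l i := by
    refine Finset.single_le_sum (f := fun l => (N * Nᵀ) i l * (N * Nᵀ) l i) (fun l _ => ?_)
      (Finset.mem_univ i)
    have : (N * Nᵀ) l i = (N * Nᵀ) i l := by
      conv_lhs => rw [← transpose_transpose N, ← transpose_mul, transpose_apply,
        transpose_transpose]
    rw [this]
    exact mul_self_nonneg _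
  rw [h0]
  nlinarith

theorem trace_compression_eq {m : ℕ} (U : Matrix (Fin n) (Fin n) ℝ) (s : Fin n → ℝ)
    (N : Matrix (Fin n) (Fin m) ℝ) :
    (Nᵀ * (U * diagonal s * Uᵀ) * N).trace = ∑ i, (∑ j, (Uᵀ * N) i j ^ 2) * s i := by
  have : Nᵀ * (U * diagonal s * Uᵀ) * N = (Uᵀ * N)ᵀ * (diagonal s * (Uᵀ * N)) := by
    simp only [transpose_mul, transpose_transpose, Matrix.mul_assoc]
  rw [this, Matrix.trace]
  simp only [diag_apply, Matrix.mul_apply (M := (Uᵀ * N)ᵀ), diagonal_mul, transpose_apply]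
  rw [Finset.sum_comm]
  refine Finset.sum_congr rfl fun i _ => ?_
  rw [Finset.sum_mul]
  exact Finset.sum_congr rfl fun j _ => by ring

/-- Ky Fan's inequality. -/
theorem trace_compression_le {k m : ℕ} {U : Matrix (Fin n) (Fin n) ℝ}
    (hU : U ∈ orthogonalGroup (Fin n) ℝ) {s : Fin n → ℝ} (hs : Antitone s) (hs0 : ∀ i, 0 ≤ s i)
    {N : Matrix (Fin n) (Fin m) ℝ} (hN : Nᵀ * N = 1) (hmk : m ≤ k) :
    (Nᵀ * (U * diagonal s * Uᵀ) * N).trace ≤ ∑ i : Fin n, if (i : ℕ) < k then s i else 0 := by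
  have hUN : (Uᵀ * N)ᵀ * (Uᵀ * N) = 1 := by
    calc _ = Nᵀ * (U * Uᵀ) * N := by
          simp only [transpose_mul, transpose_transpose, Matrix.mul_assoc]
      _ = 1 := by rw [mul_transpose_self_of_mem hU, Matrix.mul_one, hN]
  rw [trace_compression_eq]
  refine sum_mul_le_sum_leading hs hs0 (fun i => Finset.sum_nonneg fun j _ => sq_nonneg _)
    (row_sum_sq_le_one hUN) ?_
  have : ∑ i, ∑ j, (Uᵀ * N) i j ^ 2 = m := by
    rw [Finset.sum_comm]
    have h : ∀ j, ∑ i, (Uᵀ * N) i j ^ 2 = 1 := by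
      intro j
      have := congrFun (congrFun hUN j) j
      rw [Matrix.mul_apply, one_apply_eq] at this
      simpa [sq] using this
    simp [h]
  rw [this]
  exact_mod_cast hmk

/-- Equality in Ky Fan's inequality, attained at the leading columns of `U`; `min k n` allows for k
> n. -/
theorem exists_trace_compression_eq {k : ℕ} {U : Matrix (Fin n) (Fin n) ℝ}
    (hU : U ∈ orthogonalGroup (Fin n) ℝ) (s : Fin n → ℝ) :
    ∃ N : Matrix (Fin n) (Fin (min k n)) ℝ, Nᵀ * N = 1 ∧
      (Nᵀ * (U * diagonal s * Uᵀ) * N).trace = ∑ i : Fin n, if (i : ℕ) < k then s i else 0 := by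
  set e : Fin (min k n) → Fin n := Fin.castLE (min_le_right k n) with he
  have hinj : Function.Injective e := Fin.castLE_injective _
  have hU1 := transpose_mul_self_of_mem hU
  have hsub : ∀ M : Matrix (Fin n) (Fin n) ℝ,
      (U.submatrix id e)ᵀ * M * U.submatrix id e = (Uᵀ * M * U).submatrix e e := by
    intro M
    ext i j
    simp [Matrix.mul_apply]
  refine ⟨U.submatrix id e, ?_, ?_⟩
  · have := hsub 1
    rw [Matrix.mul_one, Matrix.mul_one, hU1] at this
    rw [this]
    exact submatrix_one e hinj
  · have hD : Uᵀ * (U * diagonal s * Uᵀ) * U = diagonal s := by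
      calc _ = (Uᵀ * U) * diagonal s * (Uᵀ * U) := by simp only [Matrix.mul_assoc]
        _ = _ := by rw [hU1, Matrix.one_mul, Matrix.mul_one]
    rw [hsub, hD, Matrix.trace]
    simp only [diag_apply, submatrix_apply, diagonal_apply_eq]
    rw [← Finset.sum_filter]
    refine Finset.sum_bij (fun i _ => e i) ?_ (fun a _ b _ h => hinj h) ?_ (fun _ _ => rfl)
    · intro i _
      have := i.2
      simp only [Finset.mem_filter, Finset.mem_univ, true_and, he, Fin.val_castLE]
      omega
    · intro b hb
      simp only [Finset.mem_filter, Finset.mem_univ, true_and] at hb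
      exact ⟨⟨b, lt_min hb b.2⟩, Finset.mem_univ _, rfl⟩

variable {k : ℕ} {B X : Matrix (Fin n) (Fin n) ℝ}

theorem IsTruncatedSVD.posSemidef_sub (hB : B.PosSemidef) (h : IsTruncatedSVD k B X) :
    (B - X).PosSemidef := by
  obtain ⟨U, hU, s, hs, hs0, rfl, rfl⟩ := h.exists_diagonalization hB
  have : U * diagonal s * Uᵀ
      - U * diagonal (fun i : Fin n => if (i : ℕ) < k then s i else 0) * Uᵀ
      = U * diagonal (fun i : Fin n => if (i : ℕ) < k then 0 else s i) * Uᵀ := by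
    rw [← Matrix.sub_mul, ← Matrix.mul_sub, diagonal_sub]
    congr 3
    ext i
    split_ifs <;> simp
  rw [this]
  refine posSemidef_conj_diagonal U fun i => ?_
  split_ifs
  exacts [le_rfl, hs0 i]

theorem IsTruncatedSVD.trace_compression_le (hB : B.PosSemidef) (h : IsTruncatedSVD k B X) {m : ℕ}
    {N : Matrix (Fin n) (Fin m) ℝ} (hN : Nᵀ * N = 1) (hmk : m ≤ k) :
    (Nᵀ * B * N).trace ≤ X.trace := by
  obtain ⟨U, hU, s, hs, hs0, rfl, rfl⟩ := h.exists_diagonalization hB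
  rw [trace_conj hU, trace_diagonal]
  exact FunNystrom.trace_compression_le hU hs hs0 hN hmk

theorem IsTruncatedSVD.exists_trace_compression_eq (hB : B.PosSemidef)
    (h : IsTruncatedSVD k B X) :
    ∃ N : Matrix (Fin n) (Fin (min k n)) ℝ, Nᵀ * N = 1 ∧ (Nᵀ * B * N).trace = X.trace := by
  obtain ⟨U, hU, s, hs, hs0, rfl, rfl⟩ := h.exists_diagonalization hB
  rw [trace_conj hU, trace_diagonal]
  exact FunNystrom.exists_trace_compression_eq hU s

/-- The truncation may come from a different decomposition when values are tied, but both sides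
equal the same Ky Fan maximum. -/
theorem IsTruncatedSVD.trace_eq {U : Matrix (Fin n) (Fin n) ℝ}
    (hU : U ∈ orthogonalGroup (Fin n) ℝ) {s : Fin n → ℝ} (hs : Antitone s) (hs0 : ∀ i, 0 ≤ s i)
    (h : IsTruncatedSVD k (U * diagonal s * Uᵀ) X) :
    X.trace = ∑ i : Fin n, if (i : ℕ) < k then s i else 0 := by
  have hB := posSemidef_conj_diagonal U hs0
  apply le_antisymm
  · obtain ⟨N, hN, hX⟩ := h.exists_trace_compression_eq hB
    rw [← hX]
    exact FunNystrom.trace_compression_le hU hs hs0 hN (min_le_left _ _)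
  · obtain ⟨N, hN, hX⟩ := FunNystrom.exists_trace_compression_eq (k := k) hU s
    rw [← hX]
    exact h.trace_compression_le hB hN (min_le_left _ _)

end KyFan

/-! ### Operator monotone functions are monotone and concave. -/

section OperatorMonotone

variable {f : ℝ → ℝ}

theorem cfc_diagonal {n : ℕ} (a : Fin n → ℝ) (g : ℝ → ℝ) :
    cfc g (diagonal a) = diagonal fun i => g (a i) := by
  have := cfc_conj_diagonal (one_mem (orthogonalGroup (Fin n) ℝ)) a g
  simpa using this

theorem OperatorMonotone.monotoneOn (hf : OperatorMonotone f) : MonotoneOn f (Set.Ici 0) := by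
  intro a ha b _ hab
  have h := hf 1 (diagonal fun _ => b) (diagonal fun _ => a) (PosSemidef.diagonal fun _ => ha)
    (by
      rw [diagonal_sub]
      exact PosSemidef.diagonal fun _ => sub_nonneg.2 hab)
  rw [cfc_diagonal, cfc_diagonal, diagonal_sub] at h
  have := h.diag_nonneg (i := 0)
  simpa using this

/-- A continuous operator monotone function on the half-line is concave. -/
theorem OperatorMonotone.concaveOn (hf : OperatorMonotone f)
    (hc : ContinuousOn f (Set.Ici 0)) : ConcaveOn ℝ (Set.Ici 0) f := by
  refine ⟨convex_Ici 0, ?_⟩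
  intro a ha b hb t u ht hu htu
  simp only [smul_eq_mul]
  have ha' : (0 : ℝ) ≤ a := ha
  have hb' : (0 : ℝ) ≤ b := hb
  set m := t * a + u * b with hm
  have hm0 : 0 ≤ m := by positivity
  have hbound : ∀ ε : ℝ, 0 < ε → t * f a + u * f b ≤ f (m + ε) := by
    intro ε hε
    have ht2 := Real.mul_self_sqrt ht
    have hu2 := Real.mul_self_sqrt hu
    set c := √t
    set s := √u
    -- This rotation makes the top left entry of U diag(g(a), g(b)) Uᵀ equal to t g(a) + u g(b) for
    -- every `g`, in particular for the identity and for `f`.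
    set U : Matrix (Fin 2) (Fin 2) ℝ := !![c, -s; s, c] with hUdef
    have hU : U ∈ orthogonalGroup (Fin 2) ℝ := by
      apply mem_orthogonalGroup_of_transpose_mul
      ext i j
      fin_cases i <;> fin_cases j <;> simp [hUdef, Matrix.mul_apply, Fin.sum_univ_two] <;> linarith
    set d : Fin 2 → ℝ := ![a, b]
    have hd : ∀ i, 0 ≤ d i := by
      intro i
      fin_cases i
      exacts [ha', hb']
    set x := (U * diagonal d * Uᵀ) 0 1 with hx
    set y := (U * diagonal d * Uᵀ) 1 1 with hy
    have h00 : ∀ g : ℝ → ℝ, (U * diagonal (fun i => g (d i)) * Uᵀ) 0 0 = t * g a + u * g b := by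
      intro g
      rw [Matrix.mul_apply]
      simp only [mul_diagonal]
      simp [Fin.sum_univ_two, hUdef, d]
      rw [← ht2, ← hu2]
      ring
    have h10 : (U * diagonal d * Uᵀ) 1 0 = x := by
      rw [hx, Matrix.mul_apply, Matrix.mul_apply]
      simp only [mul_diagonal]
      simp [Fin.sum_univ_two, hUdef, d]
      ring
    -- A diagonal majorant: the second entry is chosen so that the difference is v vᵀ with v = (√ε,
    -- -x/√ε). Comparing top left entries after applying `f` gives the bound.
    have h := hf 2 (diagonal ![m + ε, y + x * x / ε]) (U * diagonal d * Uᵀ)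
      (posSemidef_conj_diagonal U hd) (by
        have hv := posSemidef_vecMulVec_self_star (![√ε, -x / √ε] : Fin 2 → ℝ)
        convert hv using 1
        have hs0 : √ε ≠ 0 := (Real.sqrt_pos.2 hε).ne'
        have hs1 := Real.mul_self_sqrt hε.le
        have h00' := h00 id
        simp only [id] at h00'
        ext i j
        fin_cases i <;> fin_cases j <;>
          simp [vecMulVec, h00', h10, ← hx, ← hy, ← hm, hs1]
        · field_simp
        · field_simp
        · rw [div_mul_div_comm, hs1]; ring)
    rw [cfc_diagonal, cfc_conj_diagonal hU] at h
    have h0 := h.diag_nonneg (i := 0)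
    rw [Matrix.sub_apply, h00 f] at h0
    simpa using h0
  have hlim : Filter.Tendsto (fun ε => f (m + ε)) (nhdsWithin 0 (Set.Ioi 0)) (nhds (f m)) := by
    have h1 : Filter.Tendsto (fun ε : ℝ => m + ε) (nhdsWithin 0 (Set.Ioi 0))
        (nhdsWithin m (Set.Ici 0)) := by
      apply tendsto_nhdsWithin_of_tendsto_nhds_of_eventually_within
      · have : Filter.Tendsto (fun ε : ℝ => m + ε) (nhds 0) (nhds (m + 0)) :=
          (continuous_const.add continuous_id).tendsto 0
        rw [add_zero] at this
        exact this.mono_left nhdsWithin_le_nhds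
      · filter_upwards [self_mem_nhdsWithin] with ε hε
        exact add_nonneg hm0 (le_of_lt hε)
    exact (hc m hm0).tendsto.comp h1
  exact ge_of_tendsto hlim (by filter_upwards [self_mem_nhdsWithin] with ε hε using hbound ε hε)

end OperatorMonotone

/-! ### Deterministic lower bound from a subspace with an identity block on top. -/

section Structural

variable {n m : ℕ}

theorem sum_sq_eq_of_transpose_mul_self {N : Matrix (Fin n) (Fin m) ℝ} (hN : Nᵀ * N = 1)
    (j : Fin m) : ∑ i, N i j ^ 2 = 1 := by
  have := congrFun (congrFun hN j) j
  rw [Matrix.mul_apply, one_apply_eq] at this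
  simpa [sq] using this

theorem sum_castLE_le (h : m ≤ n) {g : Fin n → ℝ} (hg : ∀ i, 0 ≤ g i) :
    ∑ i : Fin m, g (Fin.castLE h i) ≤ ∑ i, g i := by
  have := Finset.sum_map Finset.univ (Fin.castLEEmb h) g
  simp only [Fin.castLEEmb_apply] at this
  rw [← this]
  exact Finset.sum_le_sum_of_subset_of_nonneg (Finset.subset_univ _) fun i _ _ => hg i

/-- Simultaneous diagonalization of `TᵀT` and `Tᵀ diag(a) T`, where `T` has an identity block on
top. -/
theorem exists_ritz_basis (h : m ≤ n) {a : Fin n → ℝ} (ha : ∀ i, 0 ≤ a i)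
    (hapos : ∀ i : Fin m, 0 < a (Fin.castLE h i)) {T : Matrix (Fin n) (Fin m) ℝ}
    (hT : ∀ i j, T (Fin.castLE h i) j = if i = j then 1 else 0) :
    ∃ (L : Matrix (Fin m) (Fin m) ℝ) (μ : Fin m → ℝ), (T * L)ᵀ * (T * L) = 1 ∧
      (T * L)ᵀ * diagonal a * (T * L) = diagonal μ ∧ ∀ j, 0 < μ j := by
  have htop : ∀ (M : Matrix (Fin m) (Fin m) ℝ) i j, (T * M) (Fin.castLE h i) j = M i j := by
    intro M i j
    simp [Matrix.mul_apply, hT]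
  have hGh : (Tᵀ * T).IsHermitian := by
    simp [IsHermitian, conjTranspose_eq_transpose_of_trivial]
  obtain ⟨O, hO, d, -, hd, -⟩ := exists_orthogonal_sortedEigenvalue hGh
  have hO1 := transpose_mul_self_of_mem hO
  have hOG : (T * O)ᵀ * (T * O) = diagonal d := by
    calc _ = Oᵀ * (Tᵀ * T) * O := by simp only [transpose_mul, Matrix.mul_assoc]
      _ = (Oᵀ * O) * diagonal d * (Oᵀ * O) := by rw [hd]; simp only [Matrix.mul_assoc]
      _ = _ := by rw [hO1, Matrix.one_mul, Matrix.mul_one]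
  -- The top block of T O is `O` itself, whose columns have norm one; thus TᵀT is invertible and can
  -- be normalized.
  have hdpos : ∀ j, 1 ≤ d j := by
    intro j
    have h1 := congrFun (congrFun hOG j) j
    rw [Matrix.mul_apply, diagonal_apply_eq] at h1
    simp only [transpose_apply, ← sq] at h1
    rw [← h1, ← sum_sq_eq_of_transpose_mul_self hO1 j]
    have := sum_castLE_le h (g := fun i => (T * O) i j ^ 2) fun i => sq_nonneg _
    simpa only [htop] using this
  set S := O * diagonal (fun j => (√(d j))⁻¹) with hS
  have hSG : (T * S)ᵀ * (T * S) = 1 := by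
    calc _ = diagonal (fun j => (√(d j))⁻¹) * ((T * O)ᵀ * (T * O))
            * diagonal (fun j => (√(d j))⁻¹) := by
          simp only [hS, transpose_mul, diagonal_transpose, Matrix.mul_assoc]
      _ = 1 := by
          rw [hOG, diagonal_mul_diagonal, diagonal_mul_diagonal, ← diagonal_one]
          congr 1
          ext j
          have h0 : 0 < d j := lt_of_lt_of_le one_pos (hdpos j)
          have h1 := Real.mul_self_sqrt h0.le
          have h2 : √(d j) ≠ 0 := (Real.sqrt_pos.2 h0).ne'
          field_simp
          linarith [h1]
  have hMh : ((T * S)ᵀ * diagonal a * (T * S)).IsHermitian := by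
    simp [IsHermitian, conjTranspose_eq_transpose_of_trivial, Matrix.mul_assoc]
  obtain ⟨W, hW, μ, -, hμ, -⟩ := exists_orthogonal_sortedEigenvalue hMh
  have hW1 := transpose_mul_self_of_mem hW
  have hV1 : (T * (S * W))ᵀ * (T * (S * W)) = 1 := by
    calc _ = Wᵀ * ((T * S)ᵀ * (T * S)) * W := by simp only [transpose_mul, Matrix.mul_assoc]
      _ = 1 := by rw [hSG, Matrix.mul_one, hW1]
  have hV2 : (T * (S * W))ᵀ * diagonal a * (T * (S * W)) = diagonal μ := by
    calc _ = Wᵀ * ((T * S)ᵀ * diagonal a * (T * S)) * W := by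
          simp only [transpose_mul, Matrix.mul_assoc]
      _ = (Wᵀ * W) * diagonal μ * (Wᵀ * W) := by rw [hμ]; simp only [Matrix.mul_assoc]
      _ = _ := by rw [hW1, Matrix.one_mul, Matrix.mul_one]
  refine ⟨S * W, μ, hV1, hV2, fun j => ?_⟩
  set V := T * (S * W) with hV
  have hμj : ∑ i, a i * V i j ^ 2 = μ j := by
    have h1 := congrFun (congrFun hV2 j) j
    rw [Matrix.mul_apply, diagonal_apply_eq] at h1
    simp only [mul_diagonal, transpose_apply] at h1
    rw [← h1]
    exact Finset.sum_congr rfl fun i _ => by ring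
  have hle : ∑ i : Fin m, a (Fin.castLE h i) * (S * W) i j ^ 2 ≤ μ j := by
    rw [← hμj]
    have := sum_castLE_le h (g := fun i => a i * V i j ^ 2)
      fun i => mul_nonneg (ha i) (sq_nonneg _)
    simpa only [hV, htop] using this
  have hnn : ∀ i : Fin m, 0 ≤ a (Fin.castLE h i) * (S * W) i j ^ 2 := fun i =>
    mul_nonneg (ha _) (sq_nonneg _)
  -- If μ_j were not positive, positivity of the leading `a` would kill column j of the top block S
  -- W, hence column j of `V`, which is a unit vector.
  by_contra hcon
  have h0 : ∑ i : Fin m, a (Fin.castLE h i) * (S * W) i j ^ 2 = 0 :=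
    le_antisymm (hle.trans (not_lt.1 hcon)) (Finset.sum_nonneg fun i _ => hnn i)
  have h1 : ∀ i, (S * W) i j = 0 := by
    intro i
    have := (Finset.sum_eq_zero_iff_of_nonneg fun i _ => hnn i).1 h0 i (Finset.mem_univ i)
    simpa [(hapos i).ne'] using this
  have h2 : ∀ i, V i j = 0 := by
    intro i
    rw [hV, Matrix.mul_apply]
    simp [h1]
  have := sum_sq_eq_of_transpose_mul_self hV1 j
  simp [h2] at this

/-- Here L Lᵀ = (TᵀT)⁻¹. With H = TᵀT - 1 one has (1 + H)⁻¹ = 1 - H + (HL)(HL)ᵀ ⪰ 1 - H, and the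
claim is a diagonal entry of this. -/
theorem one_sub_le_row_sum_sq {T : Matrix (Fin n) (Fin m) ℝ} {L : Matrix (Fin m) (Fin m) ℝ}
    (hV : (T * L)ᵀ * (T * L) = 1) (i : Fin m) :
    2 - ∑ r, T r i ^ 2 ≤ ∑ j, L i j ^ 2 := by
  set H := Tᵀ * T - 1 with hH
  set K := L * Lᵀ with hK
  have h1 : Lᵀ * (Tᵀ * T * L) = 1 := by
    rw [← hV]; simp only [transpose_mul, Matrix.mul_assoc]
  have h2 : Tᵀ * T * L * Lᵀ = 1 := mul_eq_one_comm.1 h1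
  have h3 : H * K = 1 - K := by
    rw [hH, Matrix.sub_mul, hK, ← Matrix.mul_assoc, h2, Matrix.one_mul]
  have hHT : Hᵀ = H := by simp [hH]
  have hKT : Kᵀ = K := by simp [hK]
  have h4 : K * H = 1 - K := by
    have := congrArg transpose h3
    simpa [transpose_mul, hHT, hKT] using this
  have h5 : 1 - K = H - (H * L) * (H * L)ᵀ := by
    have : (H * L) * (H * L)ᵀ = H * (K * H) := by
      rw [transpose_mul, hHT, hK]; simp only [Matrix.mul_assoc]
    rw [this, h4, Matrix.mul_sub, h3, Matrix.mul_one]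
    abel
  have h6 := congrFun (congrFun h5 i) i
  have h7 : 0 ≤ ((H * L) * (H * L)ᵀ) i i := by
    rw [Matrix.mul_apply]
    exact Finset.sum_nonneg fun j _ => by
      rw [transpose_apply]; exact mul_self_nonneg _
  have h8 : K i i = ∑ j, L i j ^ 2 := by simp [hK, Matrix.mul_apply, sq]
  have h9 : H i i = ∑ r, T r i ^ 2 - 1 := by simp [hH, Matrix.mul_apply, sq]
  simp only [Matrix.sub_apply, one_apply_eq, h8, h9] at h6
  linarith

theorem cfc_mul_eq_mul_diagonal {M : Matrix (Fin n) (Fin n) ℝ} (hM : M.IsHermitian)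
    {N : Matrix (Fin n) (Fin m) ℝ} {μ : Fin m → ℝ} (h : M * N = N * diagonal μ) (f : ℝ → ℝ) :
    cfc f M * N = N * diagonal fun j => f (μ j) := by
  obtain ⟨O, hO, hM', hf⟩ := exists_orthogonal_eigenvalues hM
  have hO1 := transpose_mul_self_of_mem hO
  have hO2 := mul_transpose_self_of_mem hO
  set b := hM.eigenvalues
  have h1 : diagonal b * (Oᵀ * N) = (Oᵀ * N) * diagonal μ := by
    calc _ = (Oᵀ * O) * diagonal b * Oᵀ * N := by
          rw [hO1]; simp only [Matrix.one_mul, Matrix.mul_assoc]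
      _ = Oᵀ * (O * diagonal b * Oᵀ * N) := by simp only [Matrix.mul_assoc]
      _ = _ := by rw [← hM', h]; simp only [Matrix.mul_assoc]
  have h2 : diagonal (fun i => f (b i)) * (Oᵀ * N) = (Oᵀ * N) * diagonal fun j => f (μ j) := by
    ext i j
    have := congrFun (congrFun h1 i) j
    simp only [diagonal_mul, mul_diagonal] at this ⊢
    by_cases hij : (Oᵀ * N) i j = 0
    · simp [hij]
    · rw [mul_comm] at this
      rw [mul_left_cancel₀ hij this, mul_comm]
  rw [hf]
  calc _ = O * (diagonal (fun i => f (b i)) * (Oᵀ * N)) := by simp only [Matrix.mul_assoc]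
    _ = (O * Oᵀ) * N * diagonal fun j => f (μ j) := by rw [h2]; simp only [Matrix.mul_assoc]
    _ = _ := by rw [hO2, Matrix.one_mul]

variable {f : ℝ → ℝ}

/-- Lower bound for the leading eigenvalues of `f` of the Nyström approximation of `U diag(a) Uᵀ`
from the range of `U T`, where `T` has an identity block on top. -/
theorem exists_compression_ge (hf : ConcaveOn ℝ (Set.Ici 0) f) (hf0 : ∀ x, 0 ≤ x → 0 ≤ f x)
    (h : m ≤ n) {a : Fin n → ℝ} (ha : ∀ i, 0 ≤ a i)
    (hapos : ∀ i : Fin m, 0 < a (Fin.castLE h i)) {U : Matrix (Fin n) (Fin n) ℝ}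
    (hU : U ∈ orthogonalGroup (Fin n) ℝ) {T : Matrix (Fin n) (Fin m) ℝ}
    (hT : ∀ i j, T (Fin.castLE h i) j = if i = j then 1 else 0) :
    ∃ (L : Matrix (Fin m) (Fin m) ℝ) (N : Matrix (Fin n) (Fin m) ℝ),
      (U * T * L)ᵀ * (U * T * L) = 1 ∧ Nᵀ * N = 1 ∧
      ∑ i : Fin m, f (a (Fin.castLE h i)) * (2 - ∑ r, T r i ^ 2) ≤
        (Nᵀ * cfc f ((U * diagonal (fun i => √(a i)) * Uᵀ) * ((U * T * L) * (U * T * L)ᵀ) *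
          (U * diagonal (fun i => √(a i)) * Uᵀ)) * N).trace := by
  obtain ⟨L, μ, hV1, hV2, hμ⟩ := exists_ritz_basis h ha hapos hT
  have hU1 := transpose_mul_self_of_mem hU
  have hsqrt : diagonal (fun i => √(a i)) * diagonal (fun i => √(a i)) = diagonal a := by
    rw [diagonal_mul_diagonal]
    congr 1
    ext i
    exact Real.mul_self_sqrt (ha i)
  set V := T * L with hV
  set D := diagonal (fun i => √(a i)) with hD
  set E := diagonal (fun j => (√(μ j))⁻¹) with hE
  -- Normalized eigenvectors, for the eigenvalues μ_j, of the compressed matrix U D V Vᵀ D Uᵀ.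
  set N := U * D * V * E with hN
  have hDT : Dᵀ = D := diagonal_transpose _
  have hET : Eᵀ = E := diagonal_transpose _
  have hC : (U * D * Uᵀ) * ((U * T * L) * (U * T * L)ᵀ) * (U * D * Uᵀ)
      = U * D * V * Vᵀ * D * Uᵀ := by
    calc _ = U * D * (Uᵀ * U) * (T * L) * (T * L)ᵀ * (Uᵀ * U) * D * Uᵀ := by
          simp only [transpose_mul, Matrix.mul_assoc]
      _ = _ := by rw [hU1, Matrix.mul_one, Matrix.mul_one]
  have hNN : Nᵀ * N = 1 := by
    calc _ = E * (Vᵀ * (D * (Uᵀ * U) * D) * V) * E := by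
          simp only [hN, transpose_mul, hDT, hET, Matrix.mul_assoc]
      _ = E * diagonal μ * E := by rw [hU1, Matrix.mul_one, hsqrt, hV2]
      _ = 1 := by
          rw [hE, diagonal_mul_diagonal, diagonal_mul_diagonal, ← diagonal_one]
          congr 1
          ext j
          have h1 := Real.mul_self_sqrt (hμ j).le
          have h2 : √(μ j) ≠ 0 := (Real.sqrt_pos.2 (hμ j)).ne'
          field_simp
          linarith [h1]
  have hCN : (U * D * V * Vᵀ * D * Uᵀ) * N = N * diagonal μ := by
    calc _ = U * D * V * (Vᵀ * (D * (Uᵀ * U) * D) * V) * E := by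
          simp only [hN, Matrix.mul_assoc]
      _ = U * D * V * (diagonal μ * E) := by
          rw [hU1, Matrix.mul_one, hsqrt, hV2]; simp only [Matrix.mul_assoc]
      _ = U * D * V * (E * diagonal μ) := by
          rw [hE, diagonal_mul_diagonal, diagonal_mul_diagonal]
          simp only [mul_comm]
      _ = _ := by simp only [hN, Matrix.mul_assoc]
  have hCh : (U * D * V * Vᵀ * D * Uᵀ).IsHermitian := by
    simp only [IsHermitian, conjTranspose_eq_transpose_of_trivial, transpose_mul, hDT,
      transpose_transpose, Matrix.mul_assoc]
  refine ⟨L, N, ?_, hNN, ?_⟩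
  · calc _ = Vᵀ * (Uᵀ * U) * V := by simp only [hV, transpose_mul, Matrix.mul_assoc]
      _ = 1 := by rw [hU1, Matrix.mul_one, hV1]
  · rw [hC, Matrix.mul_assoc, cfc_mul_eq_mul_diagonal hCh hCN f, ← Matrix.mul_assoc, hNN,
      Matrix.one_mul, trace_diagonal]
    have hμj : ∀ j, ∑ i, V i j ^ 2 * a i = μ j := by
      intro j
      have h1 := congrFun (congrFun hV2 j) j
      rw [Matrix.mul_apply, diagonal_apply_eq] at h1
      simp only [mul_diagonal, transpose_apply] at h1
      rw [← h1]
      exact Finset.sum_congr rfl fun i _ => by ring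
    -- μ_j is an average of the eigenvalues with weights V_ij², which sum to one.
    have hjensen : ∀ j, ∑ i, V i j ^ 2 * f (a i) ≤ f (μ j) := by
      intro j
      have := hf.le_map_sum (t := Finset.univ) (w := fun i => V i j ^ 2) (p := a)
        (fun i _ => sq_nonneg _) (sum_sq_eq_of_transpose_mul_self hV1 j) (fun i _ => ha i)
      simp only [smul_eq_mul] at this
      rwa [hμj j] at this
    have htop : ∀ i j, V (Fin.castLE h i) j = L i j := by
      intro i j
      simp [hV, Matrix.mul_apply, hT]
    calc ∑ i : Fin m, f (a (Fin.castLE h i)) * (2 - ∑ r, T r i ^ 2)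
        ≤ ∑ i : Fin m, f (a (Fin.castLE h i)) * ∑ j, L i j ^ 2 :=
          Finset.sum_le_sum fun i _ =>
            mul_le_mul_of_nonneg_left (one_sub_le_row_sum_sq hV1 i) (hf0 _ (ha _))
      _ = ∑ j, ∑ i : Fin m, V (Fin.castLE h i) j ^ 2 * f (a (Fin.castLE h i)) := by
          rw [Finset.sum_comm]
          refine Finset.sum_congr rfl fun i _ => ?_
          rw [Finset.mul_sum]
          exact Finset.sum_congr rfl fun j _ => by rw [htop, mul_comm]
      _ ≤ ∑ j, ∑ i, V i j ^ 2 * f (a i) :=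
          Finset.sum_le_sum fun j _ => sum_castLE_le h (g := fun i => V i j ^ 2 * f (a i))
            fun i => mul_nonneg (sq_nonneg _) (hf0 _ (ha _))
      _ ≤ ∑ j, f (μ j) := Finset.sum_le_sum fun j _ => hjensen j

end Structural

/-! ### The Nyström approximation as a compressed projection. -/

section Nystrom

variable {n r : ℕ} {A B : Matrix (Fin n) (Fin n) ℝ} {Q : Matrix (Fin n) (Fin r) ℝ}

/-- The Nyström approximation in terms of the orthogonal projection onto the range of
`A ^ (1 / 2) * Q`. -/
theorem exists_projection_nystrom (hB : Bᵀ = B) (hA : B * B = A) :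
    ∃ E : Matrix (Fin n) (Fin n) ℝ, Eᵀ = E ∧ E * E = E ∧ E * (B * Q) = B * Q ∧
      (∃ K : Matrix (Fin r) (Fin n) ℝ, E = B * Q * K) ∧ nystrom A Q = B * E * B := by
  set N := B * Q with hN
  have hM : Qᵀ * A * Q = Nᵀ * N := by
    rw [hN, ← hA, transpose_mul, hB]; simp only [Matrix.mul_assoc]
  set M := Qᵀ * A * Q with hMdef
  have hMT : Mᵀ = M := by rw [hM]; simp
  clear_value M
  obtain ⟨hp, -, -, -⟩ := pinv_penrose M
  -- Stated for any generalized inverse so that it applies both to `pinv M` and to its transpose;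
  -- together these force `E` to be symmetric and idempotent.
  have key : ∀ G : Matrix (Fin r) (Fin r) ℝ, M * G * M = M → N * G * Nᵀ * N = N := by
    intro G hG
    have h0 : (N * (G * M - 1))ᵀ * (N * (G * M - 1)) = 0 := by
      calc _ = (G * M - 1)ᵀ * (Nᵀ * N * (G * M - 1)) := by
            rw [transpose_mul]; simp only [Matrix.mul_assoc]
        _ = 0 := by
            rw [← hM, Matrix.mul_sub, ← Matrix.mul_assoc, hG, Matrix.mul_one, sub_self,
              Matrix.mul_zero]
    have h1 : N * (G * M - 1) = 0 := by
      apply conjTranspose_mul_self_eq_zero.mp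
      simpa only [conjTranspose_eq_transpose_of_trivial] using h0
    rw [Matrix.mul_sub, Matrix.mul_one, sub_eq_zero] at h1
    calc _ = N * (G * (Nᵀ * N)) := by simp only [Matrix.mul_assoc]
      _ = N := by rw [← hM, h1]
  set E := N * pinv M * Nᵀ with hE
  have hEN : E * N = N := key _ hp
  have hETN : Eᵀ * N = N := by
    have := key (pinv M)ᵀ (by
      have := congrArg transpose hp
      simpa only [transpose_mul, hMT, Matrix.mul_assoc] using this)
    rw [hE]
    simpa only [transpose_mul, transpose_transpose, Matrix.mul_assoc] using this
  have hEE : Eᵀ * E = E := by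
    calc Eᵀ * E = (Eᵀ * N) * pinv M * Nᵀ := by rw [hE]; simp only [Matrix.mul_assoc]
      _ = E := by rw [hETN]
  have hET : Eᵀ = E := by
    have := congrArg transpose hEE
    rw [transpose_mul, transpose_transpose, hEE] at this
    exact this.symm
  refine ⟨E, hET, ?_, hEN, ⟨pinv M * Nᵀ, Matrix.mul_assoc _ _ _⟩, ?_⟩
  · conv_lhs => enter [1]; rw [← hET]
    exact hEE
  · rw [nystrom, ← hMdef, hE, hN, ← hA, transpose_mul, hB]
    simp only [Matrix.mul_assoc]

theorem posSemidef_mul_mul_of_projection {E : Matrix (Fin n) (Fin n) ℝ} (hB : Bᵀ = B)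
    (hET : Eᵀ = E) (hEE : E * E = E) : (B * E * B).PosSemidef := by
  have := posSemidef_conjTranspose_mul_self (E * B)
  rw [conjTranspose_eq_transpose_of_trivial, transpose_mul, hB, hET] at this
  convert this using 1
  calc B * E * B = B * (E * E) * B := by rw [hEE]
    _ = _ := by simp only [Matrix.mul_assoc]

/-- When the range of `F` lies in that of `E`, the difference E - F is again an orthogonal
projection. -/
theorem posSemidef_sub_of_projection {E F : Matrix (Fin n) (Fin n) ℝ} (hB : Bᵀ = B)
    (hET : Eᵀ = E) (hEE : E * E = E) (hFT : Fᵀ = F) (hFF : F * F = F) (hEF : E * F = F) :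
    (B * E * B - B * F * B).PosSemidef := by
  have hFE : F * E = F := by
    have := congrArg transpose hEF
    rwa [transpose_mul, hET, hFT] at this
  have := posSemidef_mul_mul_of_projection (B := B) (E := E - F) hB
    (by rw [transpose_sub, hET, hFT]) (by
      rw [Matrix.mul_sub, Matrix.sub_mul, Matrix.sub_mul, hEE, hEF, hFE, hFF]; abel)
  rwa [Matrix.mul_sub, Matrix.sub_mul] at this

theorem posSemidef_nystrom (hB : Bᵀ = B) (hA : B * B = A) : (nystrom A Q).PosSemidef := by
  obtain ⟨E, hET, hEE, -, -, h⟩ := exists_projection_nystrom (Q := Q) hB hA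
  rw [h]
  exact posSemidef_mul_mul_of_projection hB hET hEE

theorem posSemidef_sub_nystrom (hB : Bᵀ = B) (hA : B * B = A) :
    (A - nystrom A Q).PosSemidef := by
  obtain ⟨E, hET, hEE, -, -, h⟩ := exists_projection_nystrom (Q := Q) hB hA
  have := posSemidef_sub_of_projection (B := B) (E := 1) (F := E) hB (by simp) (by simp) hET hEE
    (by simp)
  rwa [Matrix.mul_one, hA, ← h] at this

theorem exists_eq_mul_of_range_le {l : ℕ} {M : Matrix (Fin n) (Fin l) ℝ}
    (h : LinearMap.range M.mulVecLin ≤ LinearMap.range Q.mulVecLin) :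
    ∃ K : Matrix (Fin r) (Fin l) ℝ, M = Q * K := by
  have h1 : ∀ j, ∃ y, Q *ᵥ y = M *ᵥ Pi.single j 1 := fun j => h ⟨Pi.single j 1, rfl⟩
  choose y hy using h1
  refine ⟨Matrix.of fun i j => y j i, ?_⟩
  ext i j
  have := congrFun (hy j) i
  rw [mulVec_single_one] at this
  exact this.symm

end Nystrom

/-! ### Deterministic error bound for the sketch, and exactness at low rank. -/

section Bounds

variable {n m k l r s : ℕ} {f : ℝ → ℝ} {a : Fin n → ℝ} {U A : Matrix (Fin n) (Fin n) ℝ}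

theorem transpose_conj_diagonal (U : Matrix (Fin n) (Fin n) ℝ) (b : Fin n → ℝ) :
    (U * diagonal b * Uᵀ)ᵀ = U * diagonal b * Uᵀ := by
  simp only [transpose_mul, diagonal_transpose, transpose_transpose, Matrix.mul_assoc]

theorem conj_diagonal_mul (hU : U ∈ orthogonalGroup (Fin n) ℝ) (b c : Fin n → ℝ) :
    (U * diagonal b * Uᵀ) * (U * diagonal c * Uᵀ) = U * diagonal (fun i => b i * c i) * Uᵀ := by
  calc _ = U * diagonal b * (Uᵀ * U) * diagonal c * Uᵀ := by simp only [Matrix.mul_assoc]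
    _ = U * (diagonal b * diagonal c) * Uᵀ := by
      rw [transpose_mul_self_of_mem hU]; simp only [Matrix.mul_one, Matrix.mul_assoc]
    _ = _ := by rw [diagonal_mul_diagonal]

theorem conj_diagonal_pow (hU : U ∈ orthogonalGroup (Fin n) ℝ) (b : Fin n → ℝ) (s : ℕ) :
    (U * diagonal b * Uᵀ) ^ s = U * diagonal (fun i => b i ^ s) * Uᵀ := by
  induction s with
  | zero => simp [mul_transpose_self_of_mem hU]
  | succ s ih =>
    rw [pow_succ, ih, conj_diagonal_mul hU]
    simp only [pow_succ]

theorem conj_sqrt_mul_self (hU : U ∈ orthogonalGroup (Fin n) ℝ) (ha : ∀ i, 0 ≤ a i) :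
    (U * diagonal (fun i => √(a i)) * Uᵀ) * (U * diagonal (fun i => √(a i)) * Uᵀ)
      = U * diagonal a * Uᵀ := by
  rw [conj_diagonal_mul hU]
  congr 3
  ext i
  exact Real.mul_self_sqrt (ha i)

/-- The coordinates, in the eigenbasis, of a basis with an identity block on top of a subspace of
the range of `A ^ (1 / 2 + s) Ω`; here `G` are the coordinates of `Ω R` for a matrix `R`. -/
noncomputable def ritzCoordinates (h : m ≤ n) (a : Fin n → ℝ) (s : ℕ)
    (G : Matrix (Fin n) (Fin m) ℝ) : Matrix (Fin n) (Fin m) ℝ :=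
  diagonal (fun i => √(a i) * a i ^ s) * G *
    diagonal (fun j => (√(a (Fin.castLE h j)) * a (Fin.castLE h j) ^ s)⁻¹)

theorem ritzCoordinates_apply (h : m ≤ n) (G : Matrix (Fin n) (Fin m) ℝ) (i : Fin n) (j : Fin m) :
    ritzCoordinates h a s G i j =
      √(a i) * a i ^ s * G i j * (√(a (Fin.castLE h j)) * a (Fin.castLE h j) ^ s)⁻¹ := by
  rw [ritzCoordinates, mul_diagonal, diagonal_mul]

theorem ritzCoordinates_castLE (h : m ≤ n) (hapos : ∀ i : Fin m, 0 < a (Fin.castLE h i))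
    {G : Matrix (Fin n) (Fin m) ℝ} (hG : ∀ i j, G (Fin.castLE h i) j = if i = j then 1 else 0)
    (i j : Fin m) :
    ritzCoordinates h a s G (Fin.castLE h i) j = if i = j then 1 else 0 := by
  rw [ritzCoordinates_apply, hG]
  split_ifs with hij
  · subst hij
    rw [mul_one]
    exact mul_inv_cancel₀
      (mul_ne_zero (Real.sqrt_pos.2 (hapos i)).ne' (pow_ne_zero _ (hapos i).ne'))
  · simp

theorem mul_ritzCoordinates (hU : U ∈ orthogonalGroup (Fin n) ℝ) (h : m ≤ n)
    (Ω : Matrix (Fin n) (Fin l) ℝ) (R : Matrix (Fin l) (Fin m) ℝ) :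
    ∃ K : Matrix (Fin l) (Fin m) ℝ, U * ritzCoordinates h a s (Uᵀ * Ω * R) =
      (U * diagonal (fun i => √(a i)) * Uᵀ) * ((U * diagonal a * Uᵀ) ^ s * Ω) * K := by
  refine ⟨R * diagonal (fun j => (√(a (Fin.castLE h j)) * a (Fin.castLE h j) ^ s)⁻¹), ?_⟩
  rw [← Matrix.mul_assoc (U * diagonal (fun i => √(a i)) * Uᵀ) _ Ω, conj_diagonal_pow hU, conj_diagonal_mul hU, ritzCoordinates]
  simp only [Matrix.mul_assoc]

variable {Ω : Matrix (Fin n) (Fin l) ℝ} {R : Matrix (Fin l) (Fin m) ℝ}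
  {Q : Matrix (Fin n) (Fin r) ℝ} {X : Matrix (Fin n) (Fin n) ℝ}

theorem projection_mul_ritzCoordinates (hU : U ∈ orthogonalGroup (Fin n) ℝ) (h : m ≤ n)
    (hQ : IsOrthonormalBasisOfRange Q ((U * diagonal a * Uᵀ) ^ s * Ω))
    {E : Matrix (Fin n) (Fin n) ℝ}
    (hE : E * ((U * diagonal (fun i => √(a i)) * Uᵀ) * Q)
      = (U * diagonal (fun i => √(a i)) * Uᵀ) * Q) :
    E * (U * ritzCoordinates h a s (Uᵀ * Ω * R)) = U * ritzCoordinates h a s (Uᵀ * Ω * R) := by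
  obtain ⟨K, hK⟩ := mul_ritzCoordinates (a := a) (s := s) hU h Ω R
  obtain ⟨K', hK'⟩ := exists_eq_mul_of_range_le hQ.2.ge
  rw [hK, hK']
  calc E * ((U * diagonal (fun i => √(a i)) * Uᵀ) * (Q * K') * K)
      = E * ((U * diagonal (fun i => √(a i)) * Uᵀ) * Q) * K' * K := by
        simp only [Matrix.mul_assoc]
    _ = _ := by rw [hE]; simp only [Matrix.mul_assoc]

/-- The projection onto the range of U T lies below the one defining the Nyström matrix, so the
compressed matrix of `exists_compression_ge` is dominated by it. Operator monotonicity keeps the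
order after applying `f`, and Ky Fan compares the trace on `N` with that of the truncation. -/
theorem sum_le_trace_of_isTruncatedSVD (hf : ConcaveOn ℝ (Set.Ici 0) f)
    (hf0 : ∀ x, 0 ≤ x → 0 ≤ f x) (hfm : OperatorMonotone f) (h : m ≤ n) (hmk : m ≤ k)
    (ha : ∀ i, 0 ≤ a i) (hapos : ∀ i : Fin m, 0 < a (Fin.castLE h i))
    (hU : U ∈ orthogonalGroup (Fin n) ℝ)
    (hG : ∀ i j, (Uᵀ * Ω * R) (Fin.castLE h i) j = if i = j then 1 else 0)
    (hQ : IsOrthonormalBasisOfRange Q ((U * diagonal a * Uᵀ) ^ s * Ω))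
    (hX : IsTruncatedSVD k (cfc f (nystrom (U * diagonal a * Uᵀ) Q)) X) :
    ∑ i : Fin m, f (a (Fin.castLE h i)) *
      (2 - ∑ r, ritzCoordinates h a s (Uᵀ * Ω * R) r i ^ 2) ≤ X.trace := by
  set B := U * diagonal (fun i => √(a i)) * Uᵀ with hB
  have hBT : Bᵀ = B := transpose_conj_diagonal U _
  have hBB : B * B = U * diagonal a * Uᵀ := conj_sqrt_mul_self hU ha
  set T := ritzCoordinates h a s (Uᵀ * Ω * R) with hT
  obtain ⟨L, N, hL, hN, hle⟩ := exists_compression_ge hf hf0 h ha hapos hU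
    (ritzCoordinates_castLE (s := s) h hapos hG)
  rw [← hT, ← hB] at hle
  rw [← hT] at hL
  obtain ⟨E, hET, hEE, hEQ, -, hnys⟩ := exists_projection_nystrom (Q := Q) hBT hBB
  have hEV : E * (U * T * L) = U * T * L := by
    rw [← Matrix.mul_assoc, projection_mul_ritzCoordinates hU h hQ hEQ]
  have hsub : (nystrom (U * diagonal a * Uᵀ) Q
      - B * ((U * T * L) * (U * T * L)ᵀ) * B).PosSemidef := by
    rw [hnys]
    refine posSemidef_sub_of_projection hBT hET hEE (by simp) ?_ ?_
    · calc _ = (U * T * L) * ((U * T * L)ᵀ * (U * T * L)) * (U * T * L)ᵀ := by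
            simp only [Matrix.mul_assoc]
        _ = _ := by rw [hL, Matrix.mul_one]
    · rw [← Matrix.mul_assoc, hEV]
  have hC : (B * ((U * T * L) * (U * T * L)ᵀ) * B).PosSemidef := by
    refine posSemidef_mul_mul_of_projection hBT (by simp) ?_
    calc _ = (U * T * L) * ((U * T * L)ᵀ * (U * T * L)) * (U * T * L)ᵀ := by
            simp only [Matrix.mul_assoc]
        _ = _ := by rw [hL, Matrix.mul_one]
  have hmono := hfm n _ _ hC hsub
  have hN' : (Nᵀ * cfc f (B * ((U * T * L) * (U * T * L)ᵀ) * B) * N).trace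
      ≤ (Nᵀ * cfc f (nystrom (U * diagonal a * Uᵀ) Q) * N).trace := by
    have := (hmono.conjTranspose_mul_mul_same N).trace_nonneg
    rw [conjTranspose_eq_transpose_of_trivial, Matrix.mul_sub, Matrix.sub_mul, trace_sub] at this
    linarith
  refine (hle.trans hN').trans ?_
  obtain ⟨V, hV, b, -, hb, hbf⟩ := exists_orthogonal_sortedEigenvalue
    (posSemidef_nystrom (Q := Q) hBT hBB).isHermitian
  refine IsTruncatedSVD.trace_compression_le ?_ hX hN hmk
  have hb0 := nonneg_of_posSemidef_conj_diagonal hV (hb ▸ posSemidef_nystrom (Q := Q) hBT hBB)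
  rw [hb, cfc_conj_diagonal hV]
  exact posSemidef_conj_diagonal V fun i => hf0 _ (hb0 i)

/-- With exactly `m` positive eigenvalues the lower block of `T` vanishes, so U T spans the range of
A^(1/2) and the projection acts there as the identity. -/
theorem nystrom_eq_self (h : m ≤ n) (ha : ∀ i, 0 ≤ a i)
    (hapos : ∀ i : Fin m, 0 < a (Fin.castLE h i)) (hzero : ∀ i : Fin n, m ≤ i → a i = 0)
    (hU : U ∈ orthogonalGroup (Fin n) ℝ)
    (hG : ∀ i j, (Uᵀ * Ω * R) (Fin.castLE h i) j = if i = j then 1 else 0)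
    (hQ : IsOrthonormalBasisOfRange Q ((U * diagonal a * Uᵀ) ^ s * Ω)) :
    nystrom (U * diagonal a * Uᵀ) Q = U * diagonal a * Uᵀ := by
  set B := U * diagonal (fun i => √(a i)) * Uᵀ with hB
  have hBT : Bᵀ = B := transpose_conj_diagonal U _
  have hBB : B * B = U * diagonal a * Uᵀ := conj_sqrt_mul_self hU ha
  obtain ⟨E, hET, hEE, hEQ, -, hnys⟩ := exists_projection_nystrom (Q := Q) hBT hBB
  have hEU := projection_mul_ritzCoordinates (R := R) hU h hQ hEQ
  set T := ritzCoordinates h a s (Uᵀ * Ω * R) with hT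
  have hTtop := ritzCoordinates_castLE (s := s) h hapos hG
  have hTT : T * Tᵀ * diagonal (fun i => √(a i)) = diagonal (fun i => √(a i)) := by
    ext i j
    rw [mul_diagonal]
    by_cases hj : (j : ℕ) < m
    · have hij : (T * Tᵀ) i j = if i = j then 1 else 0 := by
        have hTj : ∀ x, T j x = if (⟨j, hj⟩ : Fin m) = x then 1 else 0 := hTtop ⟨j, hj⟩
        rw [Matrix.mul_apply]
        simp only [transpose_apply, hTj, mul_ite, mul_one, mul_zero, Finset.sum_ite_eq,
          Finset.mem_univ, if_true]
        by_cases hi : (i : ℕ) < m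
        · have hTi : ∀ x, T i x = if (⟨i, hi⟩ : Fin m) = x then 1 else 0 := hTtop ⟨i, hi⟩
          rw [hTi]
          simp [Fin.ext_iff]
        · rw [hT, ritzCoordinates_apply, hzero i (not_lt.1 hi), if_neg]
          · simp
          · rintro rfl
            exact hi hj
      rw [hij]
      by_cases h1 : i = j
      · subst h1; simp
      · simp [h1]
    · rw [hzero j (not_lt.1 hj), Real.sqrt_zero, mul_zero]
      by_cases h1 : i = j
      · subst h1; simp [hzero i (not_lt.1 hj)]
      · simp [h1]
  have hEB : E * B = B := by
    have : B = (U * T) * (Tᵀ * diagonal (fun i => √(a i)) * Uᵀ) := by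
      conv_lhs => rw [hB, ← hTT]
      simp only [Matrix.mul_assoc]
    conv_lhs => rw [this]
    rw [← Matrix.mul_assoc, hEU, ← this]
  rw [hnys, Matrix.mul_assoc, hEB, hBB]

/-- The graph lies above the chord from 0 to `y`, and f(0) ≥ 0. -/
theorem concave_mul_le (hf : ConcaveOn ℝ (Set.Ici 0) f) (hf0 : 0 ≤ f 0) {x y : ℝ} (hx : 0 ≤ x)
    (hxy : x ≤ y) (hy : 0 < y) : f y * x ≤ f x * y := by
  have h := hf.2 (Set.mem_Ici.2 (le_refl (0 : ℝ))) (Set.mem_Ici.2 hy.le)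
    (sub_nonneg.2 ((div_le_one hy).2 hxy)) (div_nonneg hx hy.le) (by ring)
  simp only [smul_eq_mul, mul_zero, zero_add, div_mul_cancel₀ _ hy.ne'] at h
  have h1 : 0 ≤ (1 - x / y) * f 0 :=
    mul_nonneg (sub_nonneg.2 ((div_le_one hy).2 hxy)) hf0
  have h2 : x / y * f y ≤ f x := by linarith
  have h3 := mul_le_mul_of_nonneg_right h2 hy.le
  calc f y * x = x / y * f y * y := by field_simp
    _ ≤ _ := h3

/-- The squared entry carries the factor (a_i/a_j)^(1+2s). One power trades f(a_j) for f(a_i) by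
concavity; the other 2s powers are bounded by γ. -/
theorem mul_ritzCoordinates_sq_le (hf : ConcaveOn ℝ (Set.Ici 0) f)
    (hf0 : ∀ x, 0 ≤ x → 0 ≤ f x) (h : m ≤ n) (ha : ∀ i, 0 ≤ a i) {γ : ℝ}
    (G : Matrix (Fin n) (Fin m) ℝ) {i : Fin n} {j : Fin m} (hj : 0 < a (Fin.castLE h j))
    (hij : a i ≤ a (Fin.castLE h j)) (hγ : a i ≤ γ * a (Fin.castLE h j)) :
    f (a (Fin.castLE h j)) * ritzCoordinates h a s G i j ^ 2
      ≤ γ ^ (2 * s) * (f (a i) * G i j ^ 2) := by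
  rw [ritzCoordinates_apply]
  set y := a (Fin.castLE h j)
  set x := a i
  have hx : 0 ≤ x := ha i
  have h1 : (√x * x ^ s * G i j * (√y * y ^ s)⁻¹) ^ 2
      = (x / y) * ((x / y) ^ s) ^ 2 * G i j ^ 2 := by
    have hx2 := Real.sq_sqrt hx
    have hy2 := Real.sq_sqrt hj.le
    rw [mul_inv, mul_pow, mul_pow, mul_pow, mul_pow, inv_pow, hx2, hy2, div_pow, inv_pow, div_pow]
    field_simp
  rw [h1]
  have h2 : f y * (x / y) ≤ f x := by
    rw [← mul_div_assoc, div_le_iff₀ hj]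
    exact concave_mul_le hf (hf0 0 le_rfl) hx hij hj
  have h3 : x / y ≤ γ := (div_le_iff₀ hj).2 hγ
  have h4 : (x / y) ^ s ≤ γ ^ s := pow_le_pow_left₀ (by positivity) h3 s
  have h5 : ((x / y) ^ s) ^ 2 ≤ γ ^ (2 * s) := by
    rw [mul_comm 2 s, pow_mul]
    exact pow_le_pow_left₀ (by positivity) h4 2
  calc f y * ((x / y) * ((x / y) ^ s) ^ 2 * G i j ^ 2)
      = (f y * (x / y)) * ((x / y) ^ s) ^ 2 * G i j ^ 2 := by ring
    _ ≤ f x * γ ^ (2 * s) * G i j ^ 2 := by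
        refine mul_le_mul_of_nonneg_right ?_ (sq_nonneg _)
        exact mul_le_mul h2 h5 (by positivity) (hf0 x hx)
    _ = _ := by ring

/-- The deterministic error bound when `a` has at least `k` positive entries. -/
theorem sum_leading_le_trace_add (hf : ConcaveOn ℝ (Set.Ici 0) f)
    (hf0 : ∀ x, 0 ≤ x → 0 ≤ f x) (hfm : OperatorMonotone f) (h : k ≤ n) (hanti : Antitone a)
    (ha : ∀ i, 0 ≤ a i) (hapos : ∀ i : Fin k, 0 < a (Fin.castLE h i)) {γ : ℝ}
    (hγ : ∀ (i : Fin n) (j : Fin k), k ≤ i → a i ≤ γ * a (Fin.castLE h j))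
    (hU : U ∈ orthogonalGroup (Fin n) ℝ) {R : Matrix (Fin l) (Fin k) ℝ}
    (hG : ∀ i j, (Uᵀ * Ω * R) (Fin.castLE h i) j = if i = j then 1 else 0)
    (hQ : IsOrthonormalBasisOfRange Q ((U * diagonal a * Uᵀ) ^ s * Ω))
    (hX : IsTruncatedSVD k (cfc f (nystrom (U * diagonal a * Uᵀ) Q)) X) :
    ∑ i : Fin k, f (a (Fin.castLE h i)) ≤ X.trace +
      γ ^ (2 * s) * ∑ j : Fin k, ∑ i : Fin n,
        if k ≤ (i : ℕ) then f (a i) * (Uᵀ * Ω * R) i j ^ 2 else 0 := by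
  have h1 := sum_le_trace_of_isTruncatedSVD hf hf0 hfm h le_rfl ha hapos hU hG hQ hX
  set G := Uᵀ * Ω * R with hGdef
  have htop := ritzCoordinates_castLE (s := s) h hapos hG
  have h2 : ∀ j : Fin k, f (a (Fin.castLE h j)) ≤
      f (a (Fin.castLE h j)) * (2 - ∑ r, ritzCoordinates h a s G r j ^ 2) +
      γ ^ (2 * s) * ∑ i : Fin n, if k ≤ (i : ℕ) then f (a i) * G i j ^ 2 else 0 := by
    intro j
    -- The identity block contributes exactly 1, which turns the factor 2 - Σ into 1 minus the lower
    -- part.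
    have h3 : ∑ r, ritzCoordinates h a s G r j ^ 2
        = 1 + ∑ i : Fin n, if k ≤ (i : ℕ) then ritzCoordinates h a s G i j ^ 2 else 0 := by
      have h4 : ∀ i : Fin n, ritzCoordinates h a s G i j ^ 2
          = (if i = Fin.castLE h j then 1 else 0)
            + if k ≤ (i : ℕ) then ritzCoordinates h a s G i j ^ 2 else 0 := by
        intro i
        by_cases hi : k ≤ (i : ℕ)
        · have : i ≠ Fin.castLE h j := by
            rintro rfl
            have := j.2
            simp only [Fin.val_castLE] at hi
            omega
          simp [hi, this]
        · have hi' : i = Fin.castLE h ⟨i, not_le.1 hi⟩ := rfl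
          rw [if_neg hi, add_zero]
          conv_lhs => rw [hi', htop]
          by_cases hij : i = Fin.castLE h j
          · have : (⟨i, not_le.1 hi⟩ : Fin k) = j := by rw [Fin.ext_iff]; simp [hij]
            simp [hij]
          · have : (⟨i, not_le.1 hi⟩ : Fin k) ≠ j := by
              rintro rfl
              exact hij rfl
            simp [hij, this]
      rw [Finset.sum_congr rfl fun i _ => h4 i, Finset.sum_add_distrib]
      simp
    rw [h3]
    have h5 : f (a (Fin.castLE h j)) *
        (∑ i : Fin n, if k ≤ (i : ℕ) then ritzCoordinates h a s G i j ^ 2 else 0)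
        ≤ γ ^ (2 * s) * ∑ i : Fin n, if k ≤ (i : ℕ) then f (a i) * G i j ^ 2 else 0 := by
      rw [Finset.mul_sum, Finset.mul_sum]
      refine Finset.sum_le_sum fun i _ => ?_
      split_ifs with hi
      · refine mul_ritzCoordinates_sq_le hf hf0 h ha G (hapos j) (hanti ?_) (hγ i j hi)
        exact Fin.le_def.2 (le_trans j.2.le hi)
      · simp
    linarith
  have h6 := Finset.sum_le_sum fun j (_ : j ∈ Finset.univ) => h2 j
  rw [Finset.sum_add_distrib, ← Finset.mul_sum] at h6
  linarith

end Bounds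

/-! ### Gaussian vectors: rotation invariance and the inverse chi-squared mean. -/

section Gaussian

/-- The law of a family of independent standard normal variables. -/
noncomputable abbrev gaussianPi (ι : Type*) [Fintype ι] : Measure (ι → ℝ) :=
  Measure.pi fun _ : ι => gaussianReal 0 1

/-- A standard Gaussian vector is mapped to a standard Gaussian vector by any matrix with
orthonormal rows. -/
theorem measurePreserving_mulVec_gaussianPi {ι κ : Type*} [Fintype ι] [Fintype κ] [DecidableEq ι]
    [DecidableEq κ] {M : Matrix κ ι ℝ} (hM : M * Mᵀ = 1) :
    MeasurePreserving (fun x => M *ᵥ x) (gaussianPi ι) (gaussianPi κ) := by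
  have hmeas : Measurable fun x : ι → ℝ => M *ᵥ x := by
    refine measurable_pi_lambda _ fun i => ?_
    simp only [mulVec, dotProduct]
    fun_prop
  refine ⟨hmeas, ?_⟩
  apply (MeasurableEquiv.toLp 2 (κ → ℝ)).map_measurableEquiv_injective
  have : IsProbabilityMeasure ((gaussianPi ι).map fun x => M *ᵥ x) :=
    Measure.isProbabilityMeasure_map hmeas.aemeasurable
  have h1 : IsProbabilityMeasure (((gaussianPi ι).map fun x => M *ᵥ x).map
      (MeasurableEquiv.toLp 2 (κ → ℝ))) :=
    Measure.isProbabilityMeasure_map (MeasurableEquiv.measurable _).aemeasurable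
  have h2 : IsProbabilityMeasure ((gaussianPi κ).map (MeasurableEquiv.toLp 2 (κ → ℝ))) :=
    Measure.isProbabilityMeasure_map (MeasurableEquiv.measurable _).aemeasurable
  apply Measure.ext_of_charFun (E := EuclideanSpace ℝ κ)
  ext t
  have hR : charFun ((gaussianPi κ).map (MeasurableEquiv.toLp 2 (κ → ℝ))) t
      = Complex.exp (-‖t‖ ^ 2 / 2) := by
    rw [← charFun_stdGaussian, ← map_pi_eq_stdGaussian]
    rfl
  have hL : charFun (((gaussianPi ι).map fun x => M *ᵥ x).map (MeasurableEquiv.toLp 2 (κ → ℝ))) t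
      = charFun ((gaussianPi ι).map (MeasurableEquiv.toLp 2 (ι → ℝ)))
          (WithLp.toLp 2 (Mᵀ *ᵥ (WithLp.ofLp t))) := by
    simp only [charFun]
    rw [integral_map_equiv, integral_map hmeas.aemeasurable, integral_map_equiv]
    · congr 1
      ext x
      congr 3
      simp only [MeasurableEquiv.coe_toLp, EuclideanSpace.inner_eq_star_dotProduct, star_trivial]
      rw [dotProduct_mulVec, ← mulVec_transpose]
    · apply Continuous.aestronglyMeasurable
      simp only [MeasurableEquiv.coe_toLp]
      fun_prop
  have hR' : charFun ((gaussianPi ι).map (MeasurableEquiv.toLp 2 (ι → ℝ)))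
      (WithLp.toLp 2 (Mᵀ *ᵥ (WithLp.ofLp t)))
      = Complex.exp (-‖(WithLp.toLp 2 (Mᵀ *ᵥ (WithLp.ofLp t)) : EuclideanSpace ℝ ι)‖ ^ 2 / 2) := by
    rw [← charFun_stdGaussian, ← map_pi_eq_stdGaussian]
    rfl
  have hnorm : ‖(WithLp.toLp 2 (Mᵀ *ᵥ (WithLp.ofLp t)) : EuclideanSpace ℝ ι)‖ ^ 2 = ‖t‖ ^ 2 := by
    rw [← real_inner_self_eq_norm_sq, ← real_inner_self_eq_norm_sq,
      EuclideanSpace.inner_eq_star_dotProduct, EuclideanSpace.inner_eq_star_dotProduct]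
    simp only [star_trivial]
    rw [dotProduct_mulVec, ← mulVec_transpose, transpose_transpose, mulVec_mulVec, hM, one_mulVec]
  rw [hL, hR', hR]
  norm_cast
  rw [hnorm]

theorem integral_exp_neg_mul_sq_gaussianReal {t : ℝ} (ht : 0 ≤ t) :
    ∫ x, Real.exp (-t * x ^ 2) ∂(gaussianReal 0 1) = (1 + 2 * t) ^ (-(1 / 2) : ℝ) := by
  rw [integral_gaussianReal_eq_integral_smul one_ne_zero]
  have h : ∀ x : ℝ, gaussianPDFReal 0 1 x • Real.exp (-t * x ^ 2)
      = (√(2 * Real.pi))⁻¹ * Real.exp (-(t + 1 / 2) * x ^ 2) := by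
    intro x
    rw [gaussianPDFReal, smul_eq_mul, mul_assoc, ← Real.exp_add]
    simp only [NNReal.coe_one, mul_one, sub_zero]
    congr 2
    ring
  simp_rw [h]
  rw [integral_const_mul, integral_gaussian, Real.rpow_neg (by positivity), ← Real.sqrt_eq_rpow,
    ← Real.sqrt_inv, ← Real.sqrt_inv, ← Real.sqrt_mul (by positivity)]
  congr 1
  have := Real.pi_pos
  field_simp
  ring

theorem lintegral_one_add_rpow {d : ℕ} (hd : 3 ≤ d) :
    ∫⁻ t in Set.Ioi (0 : ℝ), ENNReal.ofReal ((1 + 2 * t) ^ (-(d / 2) : ℝ))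
      = ENNReal.ofReal (1 / (d - 2)) := by
  have hd' : (3 : ℝ) ≤ d := by exact_mod_cast hd
  -- An antiderivative; d ≥ 3 makes its exponent negative, so it vanishes at infinity.
  set g : ℝ → ℝ := fun t => -(1 / ((d : ℝ) - 2)) * (1 + 2 * t) ^ (1 - d / 2 : ℝ) with hg
  have hderiv : ∀ t ∈ Set.Ici (0 : ℝ), HasDerivAt g ((1 + 2 * t) ^ (-(d / 2) : ℝ)) t := by
    intro t ht
    have ht' : (0 : ℝ) ≤ t := ht
    have h1 : HasDerivAt (fun t : ℝ => 1 + 2 * t) 2 t := by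
      simpa using ((hasDerivAt_id t).const_mul 2).const_add 1
    have h2 := (h1.rpow_const (p := (1 - d / 2 : ℝ)) (Or.inl (by positivity))).const_mul
      (-(1 / ((d : ℝ) - 2)))
    refine h2.congr_deriv ?_
    have h3 : (1 - (d : ℝ) / 2 - 1) = -(d / 2) := by ring
    rw [h3]
    have h4 : (d : ℝ) - 2 ≠ 0 := by linarith
    field_simp
    ring
  have hpos : ∀ t ∈ Set.Ioi (0 : ℝ), 0 ≤ (1 + 2 * t) ^ (-(d / 2) : ℝ) := by
    intro t ht
    have ht' : (0 : ℝ) < t := ht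
    positivity
  have hlim : Filter.Tendsto g Filter.atTop (nhds 0) := by
    have h1 : Filter.Tendsto (fun t : ℝ => 1 + 2 * t) Filter.atTop Filter.atTop :=
      Filter.tendsto_atTop_add_const_left _ _
        (Filter.tendsto_id.const_mul_atTop (by norm_num : (0 : ℝ) < 2))
    have h2 := (tendsto_rpow_neg_atTop (y := (d / 2 - 1 : ℝ)) (by linarith)).comp h1
    have h3 := h2.const_mul (-(1 / ((d : ℝ) - 2)))
    rw [mul_zero] at h3
    convert h3 using 2
    simp only [hg, Function.comp]
    congr 2
    ring
  have hint := integrableOn_Ioi_deriv_of_nonneg' hderiv hpos hlim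
  have hval := integral_Ioi_of_hasDerivAt_of_nonneg' hderiv hpos hlim
  rw [← ofReal_integral_eq_lintegral_ofReal hint, hval]
  · simp [hg]
  · filter_upwards [ae_restrict_mem measurableSet_Ioi] with t ht using hpos t ht

theorem lintegral_exp_neg_mul_sum_sq {d : ℕ} {t : ℝ} (ht : 0 ≤ t) :
    ∫⁻ x, ENNReal.ofReal (Real.exp (-t * ∑ i, x i ^ 2)) ∂(gaussianPi (Fin d))
      = ENNReal.ofReal ((1 + 2 * t) ^ (-(d / 2) : ℝ)) := by
  have hint : Integrable (fun x : Fin d → ℝ => Real.exp (-t * ∑ i, x i ^ 2))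
      (gaussianPi (Fin d)) := by
    refine Integrable.of_bound (C := 1) (Continuous.aestronglyMeasurable (by fun_prop))
      (ae_of_all _ fun x => ?_)
    rw [Real.norm_eq_abs, abs_of_pos (Real.exp_pos _), Real.exp_le_one_iff]
    have : 0 ≤ ∑ i, x i ^ 2 := Finset.sum_nonneg fun i _ => sq_nonneg _
    nlinarith
  rw [← ofReal_integral_eq_lintegral_ofReal hint (ae_of_all _ fun x => (Real.exp_pos _).le)]
  congr 1
  simp_rw [Finset.mul_sum, Real.exp_sum]
  rw [integral_fintype_prod_eq_prod (f := fun (_ : Fin d) (x : ℝ) => Real.exp (-t * x ^ 2))]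
  simp only [integral_exp_neg_mul_sq_gaussianReal ht, Finset.prod_const, Finset.card_univ,
    Fintype.card_fin]
  rw [← Real.rpow_natCast, ← Real.rpow_mul (by positivity)]
  congr 1
  ring

/-- Laplace representation 1/s = ∫ e^(-ts) dt, which reduces inverse moments to the moment
generating function; at s = 0 both sides are infinite. -/
theorem inv_le_lintegral_exp {s : ℝ} (hs : 0 ≤ s) :
    (ENNReal.ofReal s)⁻¹ ≤ ∫⁻ t in Set.Ioi (0 : ℝ), ENNReal.ofReal (Real.exp (-t * s)) := by
  rcases hs.eq_or_lt with rfl | hs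
  · simp
  · have hint : IntegrableOn (fun t => Real.exp (-t * s)) (Set.Ioi 0) := by
      have := integrableOn_exp_mul_Ioi (a := -s) (by linarith) 0
      refine this.congr_fun (fun t _ => ?_) measurableSet_Ioi
      beta_reduce
      congr 1
      ring
    rw [← ofReal_integral_eq_lintegral_ofReal hint (ae_of_all _ fun x => (Real.exp_pos _).le)]
    have h2 : ∫ t in Set.Ioi (0 : ℝ), Real.exp (-t * s) = s⁻¹ := by
      have := integral_exp_mul_Ioi (a := -s) (by linarith) 0
      rw [mul_zero, Real.exp_zero, neg_div_neg_eq, one_div] at this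
      rw [← this]
      refine setIntegral_congr_fun measurableSet_Ioi fun t _ => ?_
      congr 1
      ring
    rw [h2, ENNReal.ofReal_inv_of_pos hs]

/-- The mean of the inverse of a chi-squared variable with `d` degrees of freedom. -/
theorem lintegral_inv_sum_sq_le {d : ℕ} (hd : 3 ≤ d) :
    ∫⁻ x, (ENNReal.ofReal (∑ i, x i ^ 2))⁻¹ ∂(gaussianPi (Fin d))
      ≤ ENNReal.ofReal (1 / (d - 2)) := by
  calc ∫⁻ x, (ENNReal.ofReal (∑ i, x i ^ 2))⁻¹ ∂(gaussianPi (Fin d))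
      ≤ ∫⁻ x, (∫⁻ t in Set.Ioi (0 : ℝ), ENNReal.ofReal (Real.exp (-t * ∑ i, x i ^ 2)))
          ∂(gaussianPi (Fin d)) :=
        lintegral_mono fun x => inv_le_lintegral_exp (Finset.sum_nonneg fun i _ => sq_nonneg _)
    _ = ∫⁻ t in Set.Ioi (0 : ℝ), ∫⁻ x, ENNReal.ofReal (Real.exp (-t * ∑ i, x i ^ 2))
          ∂(gaussianPi (Fin d)) := by
        apply lintegral_lintegral_swap
        apply Measurable.aemeasurable
        simp only [Function.uncurry_def]
        fun_prop
    _ = ∫⁻ t in Set.Ioi (0 : ℝ), ENNReal.ofReal ((1 + 2 * t) ^ (-(d / 2) : ℝ)) :=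
        setLIntegral_congr_fun measurableSet_Ioi fun t ht =>
          lintegral_exp_neg_mul_sum_sq (le_of_lt ht)
    _ = _ := lintegral_one_add_rpow hd

/-- The linear form is centred, so its second moment is a variance, which adds over independent
coordinates. -/
theorem lintegral_dotProduct_sq {l : ℕ} (b : Fin l → ℝ) :
    ∫⁻ y, ENNReal.ofReal ((∑ j, y j * b j) ^ 2) ∂(gaussianPi (Fin l))
      = ENNReal.ofReal (∑ j, b j ^ 2) := by
  have hmem : MemLp (fun x : ℝ => x) 2 (gaussianReal 0 1) := memLp_id_gaussianReal 2
  have hsq : Integrable (fun x : ℝ => x ^ 2) (gaussianReal 0 1) := hmem.integrable_sq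
  have hmom : ∀ j, MemLp (fun y : Fin l → ℝ => y j * b j) 2 (gaussianPi (Fin l)) := by
    intro j
    have : MemLp (fun y : Fin l → ℝ => y j) 2 (gaussianPi (Fin l)) :=
      hmem.comp_measurePreserving (measurePreserving_eval (fun _ : Fin l => gaussianReal 0 1) j)
    exact this.mul_const _
  have hsum : MemLp (fun y : Fin l → ℝ => ∑ j, y j * b j) 2 (gaussianPi (Fin l)) :=
    memLp_finsetSum _ fun j _ => hmom j
  rw [← ofReal_integral_eq_lintegral_ofReal hsum.integrable_sq (ae_of_all _ fun y => sq_nonneg _)]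
  congr 1
  have hmean : ∫ y, ∑ j, y j * b j ∂(gaussianPi (Fin l)) = 0 := by
    rw [integral_finsetSum _ fun j _ => (hmom j).integrable (by norm_num)]
    refine Finset.sum_eq_zero fun j _ => ?_
    rw [integral_mul_const]
    simp [integral_eval]
  have hvar := variance_of_integral_eq_zero hsum.aestronglyMeasurable.aemeasurable hmean
  rw [← hvar]
  have hfun : (fun y : Fin l → ℝ => ∑ j, y j * b j)
      = ∑ j, fun y : Fin l → ℝ => (fun x : ℝ => b j * x) (y j) := by
    ext y
    simp [mul_comm]
  rw [hfun, variance_sum_pi]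
  · refine Finset.sum_congr rfl fun j _ => ?_
    rw [variance_const_mul]
    have : Var[fun x : ℝ => x; gaussianReal 0 1] = 1 := by
      simp
    rw [this, mul_one]
  · exact fun j => hmem.const_mul _

end Gaussian

/-! ### Gaussian matrices: inverse Gram matrices and the mean square of Ω₂Ω₁†. -/

section RandomMatrix

variable {n m l d : ℕ}

/-- Replace the `i`-th row of a matrix. -/
def replaceRow (i : Fin n) (x : Fin n × Fin l → ℝ) (y : Fin l → ℝ) : Fin n × Fin l → ℝ :=
  fun p => if p.1 = i then y p.2 else x p

/-- Resampling one row independently keeps the law; this serves as conditioning on all the other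
rows. -/
theorem measurePreserving_replaceRow (i : Fin n) :
    MeasurePreserving (fun z : (Fin n × Fin l → ℝ) × (Fin l → ℝ) => replaceRow i z.1 z.2)
      ((gaussianPi (Fin n × Fin l)).prod (gaussianPi (Fin l))) (gaussianPi (Fin n × Fin l)) := by
  have hmeas : Measurable fun z : (Fin n × Fin l → ℝ) × (Fin l → ℝ) => replaceRow i z.1 z.2 := by
    refine measurable_pi_lambda _ fun p => ?_
    by_cases hp : p.1 = i
    · simp only [replaceRow, hp, if_true]
      fun_prop
    · simp only [replaceRow, hp, if_false]
      fun_prop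
  refine ⟨hmeas, ?_⟩
  symm
  apply Measure.pi_eq
  intro s hs
  rw [Measure.map_apply hmeas (MeasurableSet.univ_pi hs)]
  have hpre : (fun z : (Fin n × Fin l → ℝ) × (Fin l → ℝ) => replaceRow i z.1 z.2) ⁻¹'
      Set.univ.pi s = (Set.univ.pi fun p => if p.1 = i then Set.univ else s p) ×ˢ
        (Set.univ.pi fun j => s (i, j)) := by
    ext ⟨x, y⟩
    simp only [Set.mem_preimage, Set.mem_pi, Set.mem_univ, true_imp_iff, Set.mem_prod, replaceRow]
    constructor
    · intro h
      refine ⟨fun p => ?_, fun j => by simpa using h (i, j)⟩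
      have := h p
      split_ifs with hp
      · trivial
      · simpa [hp] using this
    · rintro ⟨h1, h2⟩ ⟨a, b⟩
      by_cases hp : a = i
      · subst hp
        simpa using h2 b
      · simpa [hp] using h1 (a, b)
  rw [hpre, Measure.prod_prod, Measure.pi_pi, Measure.pi_pi, Fintype.prod_prod_type,
    Fintype.prod_prod_type, ← Finset.mul_prod_erase _ _ (Finset.mem_univ i),
    ← Finset.mul_prod_erase (a := i) _ (fun x => ∏ y, gaussianReal 0 1 (s (x, y)))
      (Finset.mem_univ i)]
  simp only [if_true, measure_univ, Finset.prod_const_one, one_mul]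
  rw [mul_comm]
  congr 1
  refine Finset.prod_congr rfl fun a ha => ?_
  simp [Finset.ne_of_mem_erase ha]

theorem lintegral_replaceRow (i : Fin n) {F : (Fin n × Fin l → ℝ) → ENNReal} (hF : Measurable F) :
    ∫⁻ x, F x ∂(gaussianPi (Fin n × Fin l)) =
      ∫⁻ x, ∫⁻ y, F (replaceRow i x y) ∂(gaussianPi (Fin l)) ∂(gaussianPi (Fin n × Fin l)) := by
  have h := measurePreserving_replaceRow (n := n) (l := l) i
  rw [← h.lintegral_comp hF, lintegral_prod]
  exact (hF.comp h.measurable).aemeasurable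

/-- The matrix formed by the first `m` rows. -/
def topRows (h : m ≤ n) (x : Fin n × Fin l → ℝ) : Matrix (Fin m) (Fin l) ℝ :=
  Matrix.of fun i j => x (Fin.castLE h i, j)

theorem continuous_topRows (h : m ≤ n) :
    Continuous (topRows h : (Fin n × Fin l → ℝ) → Matrix (Fin m) (Fin l) ℝ) :=
  continuous_matrix fun _ _ => continuous_apply _

/-- The regularized inverse Gram matrix of the rows of `Ω`. -/
noncomputable def gramInv (ε : ℝ) (Ω : Matrix (Fin m) (Fin l) ℝ) : Matrix (Fin m) (Fin m) ℝ :=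
  (Ω * Ωᵀ + ε • (1 : Matrix (Fin m) (Fin m) ℝ))⁻¹

theorem measurable_gramInv_topRows (h : m ≤ n) (ε : ℝ) (i j : Fin m) :
    Measurable fun x : Fin n × Fin l → ℝ => gramInv ε (topRows h x) i j := by
  have hc : Continuous fun x : Fin n × Fin l → ℝ =>
      topRows h x * (topRows h x)ᵀ + ε • (1 : Matrix (Fin m) (Fin m) ℝ) :=
    ((continuous_topRows h).matrix_mul (continuous_topRows h).matrix_transpose).add
      continuous_const
  simp only [gramInv, Matrix.inv_def, Ring.inverse_eq_inv', Matrix.smul_apply, smul_eq_mul]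
  exact hc.matrix_det.measurable.inv.mul (hc.matrix_adjugate.matrix_elem i j).measurable

/-- With C the regularized inverse and R = ΩᵀC, the rows of `P` see only Ω_j, so P maps column j of
`R` to C_jj P Ω_j. Bessel's inequality and RᵀR ⪯ C give C_jj² |PΩ_j|² ≤ C_jj. In the singular case
the inverse is 0 by convention. -/
theorem gramInv_mul_sum_sq_le_one {ε : ℝ} (hε : 0 ≤ ε) (Ω : Matrix (Fin m) (Fin l) ℝ) (j : Fin m)
    {P : Matrix (Fin d) (Fin l) ℝ} (hP : P * Pᵀ = 1) (hPΩ : ∀ i, i ≠ j → P *ᵥ Ω i = 0) :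
    0 ≤ gramInv ε Ω j j ∧ gramInv ε Ω j j * ∑ x, (P *ᵥ Ω j) x ^ 2 ≤ 1 := by
  set M := Ω * Ωᵀ + ε • (1 : Matrix (Fin m) (Fin m) ℝ) with hM
  have hg : gramInv ε Ω = M⁻¹ := rfl
  by_cases hdet : IsUnit M.det
  swap
  · have : M⁻¹ = 0 := Matrix.nonsing_inv_apply_not_isUnit M hdet
    rw [hg, this]
    simp
  have hMT : Mᵀ = M := by simp [hM]
  have hCT : (M⁻¹)ᵀ = M⁻¹ := by rw [transpose_nonsing_inv, hMT]
  have hMC : M * M⁻¹ = 1 := mul_nonsing_inv M hdet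
  set C := M⁻¹ with hC
  set R := Ωᵀ * C with hR
  have hRR : Rᵀ * R = C - ε • (C * C) := by
    have h1 : Ω * Ωᵀ = M - ε • (1 : Matrix (Fin m) (Fin m) ℝ) := by rw [hM]; simp
    calc Rᵀ * R = C * (Ω * Ωᵀ) * C := by
          rw [hR, transpose_mul, transpose_transpose, hCT]; simp only [Matrix.mul_assoc]
      _ = C * (M * C) - ε • (C * C) := by
          rw [h1, Matrix.mul_sub, Matrix.sub_mul]; simp [Matrix.mul_assoc]
      _ = _ := by rw [hMC, Matrix.mul_one]
  have hsq : ∑ x, R x j ^ 2 ≤ C j j := by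
    have h1 := congrFun (congrFun hRR j) j
    have h2 : (Rᵀ * R) j j = ∑ x, R x j ^ 2 := by simp [Matrix.mul_apply, sq]
    have h3 : (C * C) j j = ∑ x, C x j ^ 2 := by
      conv_lhs => enter [1]; rw [← hCT]
      simp [Matrix.mul_apply, sq]
    rw [h2, Matrix.sub_apply, Matrix.smul_apply, h3, smul_eq_mul] at h1
    have : 0 ≤ ε * ∑ x, C x j ^ 2 :=
      mul_nonneg hε (Finset.sum_nonneg fun x _ => sq_nonneg _)
    linarith
  have h0 : 0 ≤ C j j := le_trans (Finset.sum_nonneg fun x _ => sq_nonneg _) hsq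
  refine ⟨h0, ?_⟩
  have hPR : ∀ x, (P * R) x j = C j j * (P *ᵥ Ω j) x := by
    intro x
    have : (P * R) x j = ∑ i, (P *ᵥ Ω i) x * C i j := by
      rw [hR, ← Matrix.mul_assoc, Matrix.mul_apply]
      rfl
    rw [this, Finset.sum_eq_single j, mul_comm]
    · intro i _ hi
      rw [hPΩ i hi]
      simp
    · simp
  have hbessel : ∑ x, (P * R) x j ^ 2 ≤ ∑ x, R x j ^ 2 := by
    have h1 : (Pᵀ * P) * (Pᵀ * P) = Pᵀ * P := by
      calc _ = Pᵀ * (P * Pᵀ) * P := by simp only [Matrix.mul_assoc]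
        _ = _ := by rw [hP, Matrix.mul_one]
    have h2 : (R - Pᵀ * P * R)ᵀ * (R - Pᵀ * P * R) = Rᵀ * R - (P * R)ᵀ * (P * R) := by
      have e1 : (Pᵀ * P)ᵀ = Pᵀ * P := by simp
      calc _ = Rᵀ * R - Rᵀ * (Pᵀ * P) * R - Rᵀ * (Pᵀ * P) * R
              + Rᵀ * ((Pᵀ * P) * (Pᵀ * P)) * R := by
            rw [transpose_sub, transpose_mul (Pᵀ * P), e1]
            simp only [Matrix.sub_mul, Matrix.mul_sub, Matrix.mul_assoc]
            abel
        _ = _ := by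
            rw [h1, transpose_mul P R]
            simp only [Matrix.mul_assoc]
            abel
    have h3 := congrFun (congrFun h2 j) j
    rw [Matrix.sub_apply, Matrix.mul_apply, Matrix.mul_apply, Matrix.mul_apply] at h3
    simp only [transpose_apply, ← sq] at h3
    have : 0 ≤ ∑ x, (R - Pᵀ * P * R) x j ^ 2 := Finset.sum_nonneg fun x _ => sq_nonneg _
    linarith
  simp only [hPR, mul_pow, ← Finset.mul_sum] at hbessel
  have h4 : C j j ^ 2 * ∑ x, (P *ᵥ Ω j) x ^ 2 ≤ C j j := hbessel.trans hsq
  rw [hg]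
  rcases h0.eq_or_lt with h5 | h5
  · rw [← h5]; simp
  · nlinarith

/-- An orthonormal family of vectors orthogonal to all but one of `m` given vectors. -/
theorem exists_orthonormal_rows (v : Fin m → Fin l → ℝ) (j : Fin m) (hd : m + d ≤ l + 1) :
    ∃ P : Matrix (Fin d) (Fin l) ℝ, P * Pᵀ = 1 ∧ ∀ i, i ≠ j → P *ᵥ v i = 0 := by
  set s : Finset (Fin m) := Finset.univ.erase j with hs
  set w : Finset (EuclideanSpace ℝ (Fin l)) := s.image fun i => WithLp.toLp 2 (v i) with hw
  set K := Submodule.span ℝ (w : Set (EuclideanSpace ℝ (Fin l))) with hK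
  have h1 : Module.finrank ℝ K ≤ m - 1 := by
    refine (finrank_span_finset_le_card w).trans (Finset.card_image_le.trans ?_)
    simp [hs]
  have h2 : Module.finrank ℝ K + Module.finrank ℝ Kᗮ = l := by
    rw [Submodule.finrank_add_finrank_orthogonal]
    simp
  have hm : 0 < m := j.pos
  have h3 : d ≤ Module.finrank ℝ Kᗮ := by omega
  set b := stdOrthonormalBasis ℝ Kᗮ with hb
  refine ⟨Matrix.of fun x y => (b (Fin.castLE h3 x) : EuclideanSpace ℝ (Fin l)) y, ?_, ?_⟩
  · ext x y
    have := orthonormal_iff_ite.1 b.orthonormal (Fin.castLE h3 y) (Fin.castLE h3 x)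
    rw [Submodule.coe_inner, EuclideanSpace.inner_eq_star_dotProduct] at this
    simp only [star_trivial] at this
    rw [Matrix.mul_apply]
    refine Eq.trans this ?_
    simp [Matrix.one_apply, eq_comm]
  · intro i hi
    ext x
    have hmem : (WithLp.toLp 2 (v i) : EuclideanSpace ℝ (Fin l)) ∈ K := by
      refine Submodule.subset_span ?_
      rw [hw]
      exact_mod_cast Finset.mem_image_of_mem _ (Finset.mem_erase.2 ⟨hi, Finset.mem_univ _⟩)
    have := (Submodule.mem_orthogonal K _).1 (b (Fin.castLE h3 x)).2 _ hmem
    rw [EuclideanSpace.inner_eq_star_dotProduct] at this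
    simpa [mulVec] using this

theorem gramInv_diag_nonneg {ε : ℝ} (hε : 0 ≤ ε) (Ω : Matrix (Fin m) (Fin l) ℝ) (j : Fin m) :
    0 ≤ gramInv ε Ω j j :=
  (gramInv_mul_sum_sq_le_one (d := 0) hε Ω j (P := 0) (Subsingleton.elim _ _)
    (fun _ _ => Subsingleton.elim _ _)).1

theorem topRows_replaceRow (h : m ≤ n) (i : Fin n) (x : Fin n × Fin l → ℝ) (y : Fin l → ℝ)
    (j : Fin m) :
    topRows h (replaceRow i x y) j = if Fin.castLE h j = i then y else topRows h x j := by
  ext a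
  simp only [topRows, replaceRow, of_apply]
  split_ifs <;> rfl

/-- Bound for the mean of the diagonal entries of an inverse Wishart matrix. -/
theorem lintegral_gramInv_le (h : m ≤ n) {ε : ℝ} (hε : 0 ≤ ε) (hd : 3 ≤ d) (hml : m + d ≤ l + 1)
    (j : Fin m) :
    ∫⁻ x, ENNReal.ofReal (gramInv ε (topRows h x) j j) ∂(gaussianPi (Fin n × Fin l))
      ≤ ENNReal.ofReal (1 / (d - 2)) := by
  rw [lintegral_replaceRow (Fin.castLE h j)
    (measurable_gramInv_topRows h ε j j).ennreal_ofReal]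
  calc _ ≤ ∫⁻ _ : Fin n × Fin l → ℝ, ENNReal.ofReal (1 / (d - 2))
        ∂(gaussianPi (Fin n × Fin l)) := by
        refine lintegral_mono fun x => ?_
        -- `P` is chosen before the new row `y` and is orthogonal only to the unchanged rows, so `P
        -- *ᵥ y` is a standard Gaussian vector in dimension `d`.
        obtain ⟨P, hP, hPx⟩ := exists_orthonormal_rows (topRows h x) j hml
        have hpres := measurePreserving_mulVec_gaussianPi hP
        have hmeas : Measurable fun z : Fin d → ℝ => (ENNReal.ofReal (∑ i, z i ^ 2))⁻¹ := by
          fun_prop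
        calc ∫⁻ y, ENNReal.ofReal
              (gramInv ε (topRows h (replaceRow (Fin.castLE h j) x y)) j j) ∂(gaussianPi (Fin l))
            ≤ ∫⁻ y, (ENNReal.ofReal (∑ i, (P *ᵥ y) i ^ 2))⁻¹ ∂(gaussianPi (Fin l)) := by
              refine lintegral_mono fun y => ?_
              obtain ⟨h0, h1⟩ := gramInv_mul_sum_sq_le_one hε
                (topRows h (replaceRow (Fin.castLE h j) x y)) j hP (fun i hi => by
                  rw [topRows_replaceRow, if_neg, hPx i hi]
                  exact fun hc => hi (Fin.castLE_injective h hc))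
              rw [topRows_replaceRow, if_pos rfl] at h1
              rw [ENNReal.le_inv_iff_mul_le, ← ENNReal.ofReal_mul h0]
              exact ENNReal.ofReal_le_one.2 h1
          _ = ∫⁻ z, (ENNReal.ofReal (∑ i, z i ^ 2))⁻¹ ∂(gaussianPi (Fin d)) :=
              hpres.lintegral_comp hmeas
          _ ≤ _ := lintegral_inv_sum_sq_le hd
    _ = _ := by simp

/-- A zero eigenvalue of the Gram matrix contributes 1/ε to the trace. -/
theorem one_le_mul_trace_gramInv {ε : ℝ} (hε : 0 < ε) {Ω : Matrix (Fin m) (Fin l) ℝ}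
    (hdet : (Ω * Ωᵀ).det = 0) : 1 / ε ≤ ∑ j, gramInv ε Ω j j := by
  have hΩ : (Ω * Ωᵀ).PosSemidef := by
    simpa [conjTranspose_eq_transpose_of_trivial] using posSemidef_self_mul_conjTranspose Ω
  obtain ⟨U, hU, a, -, ha, -⟩ := exists_orthogonal_sortedEigenvalue hΩ.isHermitian
  have ha0 := nonneg_of_posSemidef_conj_diagonal hU (ha ▸ hΩ)
  have hU2 := mul_transpose_self_of_mem hU
  have hM : Ω * Ωᵀ + ε • (1 : Matrix (Fin m) (Fin m) ℝ)
      = U * diagonal (fun i => a i + ε) * Uᵀ := by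
    have : diagonal (fun i => a i + ε) = diagonal a + ε • (1 : Matrix (Fin m) (Fin m) ℝ) := by
      rw [← diagonal_one, ← diagonal_smul, diagonal_add]
      simp
    rw [this, Matrix.mul_add, Matrix.add_mul, ← ha]
    simp [hU2]
  have hinv : gramInv ε Ω = U * diagonal (fun i => (a i + ε)⁻¹) * Uᵀ := by
    rw [gramInv]
    apply inv_eq_right_inv
    rw [hM, conj_diagonal_mul hU]
    have : (fun i => (a i + ε) * (a i + ε)⁻¹) = fun _ => 1 := by
      ext i
      exact mul_inv_cancel₀ (by linarith [ha0 i])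
    rw [this, diagonal_one, Matrix.mul_one, hU2]
  have htr : ∑ j, gramInv ε Ω j j = ∑ i, (a i + ε)⁻¹ := by
    change (gramInv ε Ω).trace = _
    rw [hinv, trace_conj hU, trace_diagonal]
  have hprod : ∏ i, a i = 0 := by
    rw [← det_diagonal, ← hdet, ha, det_mul_comm, ← Matrix.mul_assoc,
      transpose_mul_self_of_mem hU, Matrix.one_mul]
  obtain ⟨i, -, hi⟩ := Finset.prod_eq_zero_iff.1 hprod
  rw [htr]
  have := Finset.single_le_sum (f := fun i => (a i + ε)⁻¹)
    (fun i _ => inv_nonneg.2 (by linarith [ha0 i])) (Finset.mem_univ i)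
  simpa [hi] using this

/-- On the singular set the regularized trace is at least 1/ε, while its mean is at most `m` for
every ε; Markov's inequality with ε → 0 makes the set null. -/
theorem ae_det_gram_ne_zero (h : m ≤ n) (hml : m + 2 ≤ l) :
    ∀ᵐ x ∂(gaussianPi (Fin n × Fin l)), (topRows h x * (topRows h x)ᵀ).det ≠ 0 := by
  rw [ae_iff]
  set μ := gaussianPi (Fin n × Fin l)
  set s := {x : Fin n × Fin l → ℝ | ¬ (topRows h x * (topRows h x)ᵀ).det ≠ 0} with hs
  have hbound : ∀ N : ℕ, (N + 1 : ENNReal) * μ s ≤ m := by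
    intro N
    have hε : (0 : ℝ) < 1 / (N + 1) := by positivity
    have hsub : s ⊆ {x | (N + 1 : ENNReal) ≤
        ∑ j, ENNReal.ofReal (gramInv (1 / (N + 1)) (topRows h x) j j)} := by
      intro x hx
      have h1 := one_le_mul_trace_gramInv hε (not_not.1 hx)
      rw [one_div_one_div] at h1
      rw [Set.mem_ofPred_eq, ← ENNReal.ofReal_sum_of_nonneg
        fun j _ => gramInv_diag_nonneg hε.le _ j]
      refine le_trans ?_ (ENNReal.ofReal_le_ofReal h1)
      rw [ENNReal.ofReal_add (by positivity) zero_le_one]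
      simp
    calc (N + 1 : ENNReal) * μ s ≤ (N + 1 : ENNReal) * μ _ := by gcongr
      _ ≤ ∫⁻ x, ∑ j, ENNReal.ofReal (gramInv (1 / (N + 1)) (topRows h x) j j) ∂μ :=
          mul_meas_ge_le_lintegral₀ (Measurable.aemeasurable
            (Finset.measurable_sum _ fun j _ =>
              (measurable_gramInv_topRows h _ j j).ennreal_ofReal)) _
      _ = ∑ j, ∫⁻ x, ENNReal.ofReal (gramInv (1 / (N + 1)) (topRows h x) j j) ∂μ :=
          lintegral_finsetSum _ fun j _ => (measurable_gramInv_topRows h _ j j).ennreal_ofReal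
      -- Three degrees of freedom, the fewest with a finite inverse mean, suffice; this is where m +
      -- 2 ≤ l is used.
      _ ≤ ∑ _j : Fin m, ENNReal.ofReal (1 / ((3 : ℕ) - 2)) :=
          Finset.sum_le_sum fun j _ => lintegral_gramInv_le h hε.le le_rfl (by omega) j
      _ = m := by norm_num
  by_contra hne
  have hfin : μ s ≠ ⊤ := measure_ne_top _ _
  obtain ⟨N, hN⟩ := ENNReal.exists_nat_mul_gt hne (ENNReal.natCast_ne_top m)
  have : (N : ENNReal) * μ s ≤ (N + 1 : ENNReal) * μ s := by
    gcongr
    exact le_self_add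
  exact absurd (hN.trans_le (this.trans (hbound N))) (lt_irrefl _)

/-- The right inverse of the first `m` rows, when they are linearly independent. -/
noncomputable def topRightInv (h : m ≤ n) (x : Fin n × Fin l → ℝ) : Matrix (Fin l) (Fin m) ℝ :=
  (topRows h x)ᵀ * gramInv 0 (topRows h x)

theorem topRows_mul_topRightInv (h : m ≤ n) {x : Fin n × Fin l → ℝ}
    (hx : (topRows h x * (topRows h x)ᵀ).det ≠ 0) : topRows h x * topRightInv h x = 1 := by
  rw [topRightInv, ← Matrix.mul_assoc, gramInv, zero_smul, add_zero]
  exact mul_nonsing_inv _ (isUnit_iff_ne_zero.2 hx)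

theorem sum_topRightInv_sq (h : m ≤ n) (x : Fin n × Fin l → ℝ) (j : Fin m) :
    ∑ y, topRightInv h x y j ^ 2 = gramInv 0 (topRows h x) j j := by
  set M := topRows h x * (topRows h x)ᵀ with hM
  have hg : gramInv 0 (topRows h x) = M⁻¹ := by rw [gramInv, zero_smul, add_zero]
  have hMT : Mᵀ = M := by simp [hM]
  have h1 : (topRightInv h x)ᵀ * topRightInv h x = M⁻¹ := by
    calc _ = (M⁻¹)ᵀ * M * M⁻¹ := by
          rw [topRightInv, hg, transpose_mul, transpose_transpose, hM]
          simp only [Matrix.mul_assoc]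
      _ = M⁻¹ := by
          rw [transpose_nonsing_inv, hMT]
          by_cases hdet : IsUnit M.det
          · rw [nonsing_inv_mul M hdet, Matrix.one_mul]
          · rw [nonsing_inv_apply_not_isUnit M hdet, Matrix.mul_zero]
  have h2 := congrFun (congrFun h1 j) j
  rw [Matrix.mul_apply] at h2
  rw [hg, ← h2]
  simp [sq]

theorem measurable_topRightInv (h : m ≤ n) (y : Fin l) (j : Fin m) :
    Measurable fun x : Fin n × Fin l → ℝ => topRightInv h x y j := by
  simp only [topRightInv, Matrix.mul_apply, transpose_apply]
  refine Finset.measurable_sum _ fun i _ => ?_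
  exact ((continuous_topRows h).matrix_elem i y).measurable.mul
    (measurable_gramInv_topRows h 0 i j)

theorem topRightInv_replaceRow (h : m ≤ n) {i : Fin n} (hi : m ≤ i) (x : Fin n × Fin l → ℝ)
    (y : Fin l → ℝ) : topRightInv h (replaceRow i x y) = topRightInv h x := by
  have : topRows h (replaceRow i x y) = topRows h x := by
    ext j
    rw [topRows_replaceRow, if_neg]
    rintro rfl
    have := j.2
    simp only [Fin.val_castLE] at hi
    omega
  rw [topRightInv, this, topRightInv]

/-- The mean square of an entry of `Ω₂ Ω₁†`. -/
theorem lintegral_mul_topRightInv_sq_le (h : m ≤ n) {i : Fin n} (hi : m ≤ i) (j : Fin m)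
    (hd : 3 ≤ d) (hml : m + d ≤ l + 1) :
    ∫⁻ x, ENNReal.ofReal ((∑ y, x (i, y) * topRightInv h x y j) ^ 2)
      ∂(gaussianPi (Fin n × Fin l)) ≤ ENNReal.ofReal (1 / (d - 2)) := by
  have hmeas : Measurable fun x : Fin n × Fin l → ℝ =>
      ENNReal.ofReal ((∑ y, x (i, y) * topRightInv h x y j) ^ 2) := by
    refine Measurable.ennreal_ofReal (Measurable.pow_const ?_ 2)
    exact Finset.measurable_sum _ fun y _ =>
      (measurable_pi_apply _).mul (measurable_topRightInv h y j)
  rw [lintegral_replaceRow i hmeas]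
  refine le_trans (le_of_eq ?_) (lintegral_gramInv_le h le_rfl hd hml j)
  refine lintegral_congr fun x => ?_
  simp only [topRightInv_replaceRow h hi, replaceRow, if_true]
  rw [lintegral_dotProduct_sq, sum_topRightInv_sq]

/-- Invariance of the law of a Gaussian matrix under orthogonal transformations. -/
theorem measurePreserving_orthogonal_mul {U : Matrix (Fin n) (Fin n) ℝ}
    (hU : U ∈ orthogonalGroup (Fin n) ℝ) :
    MeasurePreserving
      (fun (x : Fin n × Fin l → ℝ) (p : Fin n × Fin l) => ∑ i, U i p.1 * x (i, p.2))
      (gaussianPi (Fin n × Fin l)) (gaussianPi (Fin n × Fin l)) := by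
  -- On vectorized matrices, left multiplication by Uᵀ is the orthogonal matrix Uᵀ ⊗ 1.
  have hM : (Uᵀ.kroneckerMap (· * ·) (1 : Matrix (Fin l) (Fin l) ℝ))
      * (Uᵀ.kroneckerMap (· * ·) (1 : Matrix (Fin l) (Fin l) ℝ))ᵀ = 1 := by
    rw [← kroneckerMap_transpose, transpose_transpose, transpose_one]
    exact (mul_kronecker_mul _ _ _ _).symm.trans (by
      rw [transpose_mul_self_of_mem hU, Matrix.one_mul, one_kronecker_one])
  convert measurePreserving_mulVec_gaussianPi hM using 1
  ext x p
  simp [mulVec, dotProduct, Fintype.sum_prod_type, Matrix.one_apply]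

end RandomMatrix

/-! ### Measurability of the trace of the truncation. -/

section Measurability

variable {α : Type*} [MeasurableSpace α] {n m l k : ℕ}

theorem measurable_matrix_mul {M : α → Matrix (Fin n) (Fin m) ℝ} {N : α → Matrix (Fin m) (Fin l) ℝ}
    (hM : ∀ i j, Measurable fun a => M a i j) (hN : ∀ i j, Measurable fun a => N a i j)
    (i : Fin n) (j : Fin l) : Measurable fun a => (M a * N a) i j := by
  simp only [Matrix.mul_apply]
  exact Finset.measurable_sum _ fun x _ => (hM i x).mul (hN x j)

theorem measurable_matrix_aeval {M : α → Matrix (Fin n) (Fin n) ℝ}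
    (hM : ∀ i j, Measurable fun a => M a i j) (p : Polynomial ℝ) (i j : Fin n) :
    Measurable fun a => Polynomial.aeval (M a) p i j := by
  have hpow : ∀ (s : ℕ) (i j : Fin n), Measurable fun a => (M a ^ s) i j := by
    intro s
    induction s with
    | zero => intro i j; simp only [pow_zero]; exact measurable_const
    | succ s ih =>
      intro i j
      simp only [pow_succ]
      exact measurable_matrix_mul ih hM i j
  simp only [Polynomial.aeval_eq_sum_range, Matrix.sum_apply, Matrix.smul_apply, smul_eq_mul]
  exact Finset.measurable_sum _ fun s _ => (hpow s i j).const_mul _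

/-- Pointwise convergence suffices because only finitely many eigenvalues are involved. -/
theorem tendsto_cfc_apply {M : Matrix (Fin n) (Fin n) ℝ} (hM : M.IsHermitian) {g : ℕ → ℝ → ℝ}
    {g' : ℝ → ℝ} (hg : ∀ x, Filter.Tendsto (fun N => g N x) Filter.atTop (nhds (g' x)))
    (i j : Fin n) :
    Filter.Tendsto (fun N => cfc (g N) M i j) Filter.atTop (nhds (cfc g' M i j)) := by
  obtain ⟨U, hU, -, hf⟩ := exists_orthogonal_eigenvalues hM
  simp only [hf]
  have h : ∀ g : ℝ → ℝ, (U * diagonal (fun i => g (hM.eigenvalues i)) * Uᵀ) i j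
      = ∑ x, U i x * g (hM.eigenvalues x) * U j x := by
    intro g
    rw [Matrix.mul_apply]
    simp only [mul_diagonal, transpose_apply]
  simp only [h]
  exact tendsto_finsetSum _ fun x _ => ((hg _).const_mul _).mul_const _

/-- Polynomials in `M` have measurable entries; polynomials approximating `g` on growing intervals
converge to it pointwise. -/
theorem measurable_cfc_of_continuous {M : α → Matrix (Fin n) (Fin n) ℝ}
    (hM : ∀ i j, Measurable fun a => M a i j) (hMh : ∀ a, (M a).IsHermitian) {g : ℝ → ℝ}
    (hg : Continuous g) (i j : Fin n) : Measurable fun a => cfc g (M a) i j := by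
  have h : ∀ N : ℕ, ∃ p : Polynomial ℝ, ∀ x ∈ Set.Icc (-(N : ℝ)) N,
      |p.eval x - g x| < 1 / (N + 1) := fun N =>
    exists_polynomial_near_of_continuousOn _ _ g hg.continuousOn _ (by positivity)
  choose p hp using h
  have hlim : ∀ x, Filter.Tendsto (fun N => (p N).eval x) Filter.atTop (nhds (g x)) := by
    intro x
    rw [tendsto_iff_dist_tendsto_zero]
    refine squeeze_zero' (Filter.Eventually.of_forall fun _ => dist_nonneg) ?_
      tendsto_one_div_add_atTop_nhds_zero_nat
    obtain ⟨N₀, hN₀⟩ := exists_nat_ge |x|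
    filter_upwards [Filter.eventually_ge_atTop N₀] with N hN
    have : |x| ≤ N := hN₀.trans (by exact_mod_cast hN)
    exact (hp N x ⟨(abs_le.1 this).1, (abs_le.1 this).2⟩).le
  refine measurable_of_tendsto_metrizable
    (f := fun (N : ℕ) a => cfc (fun x => (p N).eval x) (M a) i j) (fun N => ?_)
    (tendsto_pi_nhds.2 fun a => tendsto_cfc_apply (hMh a) hlim i j)
  have : ∀ a, cfc (fun x => (p N).eval x) (M a) = Polynomial.aeval (M a) (p N) := fun a =>
    cfc_polynomial (p N) (M a) (hMh a)
  simp only [this]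
  exact measurable_matrix_aeval hM (p N) i j

/-- The indicator of the nonzero reals, which maps `M Mᵀ` to the projection onto the range of
`M`. -/
noncomputable def supportIndicator (x : ℝ) : ℝ := if x = 0 then 0 else 1

theorem measurable_cfc_supportIndicator {M : α → Matrix (Fin n) (Fin n) ℝ}
    (hM : ∀ i j, Measurable fun a => M a i j) (hMh : ∀ a, (M a).IsHermitian) (i j : Fin n) :
    Measurable fun a => cfc supportIndicator (M a) i j := by
  have hlim : ∀ x, Filter.Tendsto (fun N : ℕ => min 1 ((N : ℝ) * |x|)) Filter.atTop
      (nhds (supportIndicator x)) := by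
    intro x
    by_cases hx : x = 0
    · simp [supportIndicator, hx]
    · rw [supportIndicator, if_neg hx]
      refine tendsto_const_nhds.congr' ?_
      obtain ⟨N₀, hN₀⟩ := exists_nat_ge (1 / |x|)
      filter_upwards [Filter.eventually_ge_atTop N₀] with N hN
      have h1 : 1 / |x| ≤ N := hN₀.trans (by exact_mod_cast hN)
      rw [min_eq_left]
      rwa [div_le_iff₀ (abs_pos.2 hx)] at h1
  exact measurable_of_tendsto_metrizable
    (f := fun (N : ℕ) a => cfc (fun x => min 1 ((N : ℝ) * |x|)) (M a) i j)
    (fun N => measurable_cfc_of_continuous hM hMh (by fun_prop) i j)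
    (tendsto_pi_nhds.2 fun a => tendsto_cfc_apply (hMh a) hlim i j)

/-- Two symmetric matrices with E F = F and F E = E coincide, by transposing; both act as the
identity on the range of `M` and have their range inside it. -/
theorem eq_cfc_supportIndicator {M : Matrix (Fin n) (Fin l) ℝ} {E : Matrix (Fin n) (Fin n) ℝ}
    (hET : Eᵀ = E) (hEM : E * M = M) {K : Matrix (Fin l) (Fin n) ℝ} (hK : E = M * K) :
    E = cfc supportIndicator (M * Mᵀ) := by
  have hMh : (M * Mᵀ).IsHermitian := by
    simp [IsHermitian, conjTranspose_eq_transpose_of_trivial]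
  obtain ⟨U, hU, hb, hf⟩ := exists_orthogonal_eigenvalues hMh
  set b := hMh.eigenvalues
  rw [hf]
  set F := U * diagonal (fun i => supportIndicator (b i)) * Uᵀ with hF
  have hFT : Fᵀ = F := transpose_conj_diagonal U _
  have h1 : F = M * Mᵀ * (U * diagonal (fun i => (b i)⁻¹) * Uᵀ) := by
    conv_rhs => rw [hb]
    rw [conj_diagonal_mul hU, hF]
    congr 3
    ext i
    by_cases hi : b i = 0 <;> simp [supportIndicator, hi]
  have h2 : F * (M * Mᵀ) = M * Mᵀ := by
    conv_rhs => rw [hb]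
    conv_lhs => rw [hb]
    rw [hF, conj_diagonal_mul hU]
    congr 3
    ext i
    by_cases hi : b i = 0 <;> simp [supportIndicator, hi]
  have h3 : F * M = M := by
    have : (F * M - M) * (F * M - M)ᵀ = 0 := by
      calc _ = (F * (M * Mᵀ) - M * Mᵀ) * (F - 1)ᵀ := by
            have : F * M - M = (F - 1) * M := by rw [Matrix.sub_mul, Matrix.one_mul]
            rw [this, transpose_mul]
            simp only [Matrix.sub_mul, Matrix.one_mul, Matrix.mul_assoc]
        _ = 0 := by rw [h2, sub_self, Matrix.zero_mul]
    rw [← sub_eq_zero]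
    apply self_mul_conjTranspose_eq_zero.mp
    simpa only [conjTranspose_eq_transpose_of_trivial] using this
  have h4 : E * F = F := by
    rw [h1, Matrix.mul_assoc, ← Matrix.mul_assoc, hEM]
  have h5 : F * E = E := by rw [hK, ← Matrix.mul_assoc, h3]
  have h6 := congrArg transpose h5
  rw [transpose_mul, hET, hFT, h4] at h6
  exact h6.symm

/-- Eliminates the arbitrary basis `Q`, whose choice and number of columns need not be measurable.
-/
theorem nystrom_eq_cfc {r : ℕ} {A B : Matrix (Fin n) (Fin n) ℝ} {Q : Matrix (Fin n) (Fin r) ℝ}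
    {M : Matrix (Fin n) (Fin l) ℝ} (hB : Bᵀ = B) (hA : B * B = A)
    (hQ : IsOrthonormalBasisOfRange Q M) :
    nystrom A Q = B * cfc supportIndicator ((B * M) * (B * M)ᵀ) * B := by
  obtain ⟨E, hET, hEE, hEQ, ⟨K, hK⟩, h⟩ := exists_projection_nystrom (Q := Q) hB hA
  obtain ⟨K₁, hK₁⟩ := exists_eq_mul_of_range_le hQ.2.ge
  obtain ⟨K₂, hK₂⟩ := exists_eq_mul_of_range_le hQ.2.le
  rw [h, ← eq_cfc_supportIndicator (K := K₂ * K) hET]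
  · rw [hK₁, ← Matrix.mul_assoc B, ← Matrix.mul_assoc E, hEQ]
  · rw [hK]
    conv_lhs => rw [hK₂]
    simp only [Matrix.mul_assoc]

/-- Replaces `f`, possibly continuous only on the half-line, by an extension continuous on ℝ. -/
theorem cfc_eq_cfc_max {M : Matrix (Fin n) (Fin n) ℝ} (hM : M.PosSemidef) (f : ℝ → ℝ) :
    cfc f M = cfc (fun x => f (max x 0)) M := by
  obtain ⟨U, hU, -, hf⟩ := exists_orthogonal_eigenvalues hM.isHermitian
  rw [hf, hf]
  congr 3
  ext i
  rw [max_eq_left (hM.eigenvalues_nonneg i)]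

theorem IsTruncatedSVD.ofReal_trace_eq_iSup {B X : Matrix (Fin n) (Fin n) ℝ} (hB : B.PosSemidef)
    (h : IsTruncatedSVD k B X) :
    ENNReal.ofReal X.trace = ⨆ N : {N : Matrix (Fin n) (Fin (min k n)) ℝ // Nᵀ * N = 1},
      ENNReal.ofReal (N.1ᵀ * B * N.1).trace := by
  apply le_antisymm
  · obtain ⟨N, hN, hX⟩ := h.exists_trace_compression_eq hB
    rw [← hX]
    exact le_iSup (fun N : {N : Matrix (Fin n) (Fin (min k n)) ℝ // Nᵀ * N = 1} =>
      ENNReal.ofReal (N.1ᵀ * B * N.1).trace) ⟨N, hN⟩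
  · exact iSup_le fun N => ENNReal.ofReal_le_ofReal
      (h.trace_compression_le hB N.2 (min_le_left _ _))

/-- The supremum is uncountable, but a supremum of continuous functions is lower semicontinuous,
hence Borel. -/
theorem measurable_iSup_trace_compression {H : α → Matrix (Fin n) (Fin n) ℝ}
    (hH : ∀ i j, Measurable fun a => H a i j) :
    Measurable fun a => ⨆ N : {N : Matrix (Fin n) (Fin m) ℝ // Nᵀ * N = 1},
      ENNReal.ofReal (N.1ᵀ * H a * N.1).trace := by
  have h1 : LowerSemicontinuous fun B : Fin n → Fin n → ℝ =>
      ⨆ N : {N : Matrix (Fin n) (Fin m) ℝ // Nᵀ * N = 1},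
        ENNReal.ofReal (N.1ᵀ * Matrix.of B * N.1).trace := by
    refine lowerSemicontinuous_iSup fun N => Continuous.lowerSemicontinuous ?_
    refine ENNReal.continuous_ofReal.comp ?_
    have : Continuous fun B : Fin n → Fin n → ℝ => Matrix.of B := continuous_id
    exact ((continuous_const.matrix_mul this).matrix_mul continuous_const).matrix_trace
  exact h1.measurable.comp
    (measurable_pi_lambda _ fun i => measurable_pi_lambda _ fun j => hH i j)

/-- The trace of the truncated matrix function of the Nyström approximation is a measurable
function of the entries of the test matrix. -/
theorem exists_measurable_trace {f : ℝ → ℝ} (hf : ContinuousOn f (Set.Ici 0))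
    (hf0 : ∀ x, 0 ≤ x → 0 ≤ f x) {A B : Matrix (Fin n) (Fin n) ℝ} (hB : Bᵀ = B) (hA : B * B = A)
    (s k l : ℕ) :
    ∃ Φ : (Fin n × Fin l → ℝ) → ℝ, Measurable Φ ∧
      ∀ (Ω : Matrix (Fin n) (Fin l) ℝ) (r : ℕ) (Q : Matrix (Fin n) (Fin r) ℝ)
        (X : Matrix (Fin n) (Fin n) ℝ), IsOrthonormalBasisOfRange Q (A ^ s * Ω) →
        IsTruncatedSVD k (cfc f (nystrom A Q)) X → X.trace = Φ fun p => Ω p.1 p.2 := by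
  set M : (Fin n × Fin l → ℝ) → Matrix (Fin n) (Fin l) ℝ := fun x =>
    B * (A ^ s * Matrix.of fun i j => x (i, j)) with hM
  have hMm : ∀ i j, Measurable fun x => M x i j :=
    measurable_matrix_mul (fun _ _ => measurable_const)
      (measurable_matrix_mul (fun _ _ => measurable_const) fun i j => measurable_pi_apply _)
  set Y : (Fin n × Fin l → ℝ) → Matrix (Fin n) (Fin n) ℝ := fun x =>
    B * cfc supportIndicator (M x * (M x)ᵀ) * B with hY
  have hYm : ∀ i j, Measurable fun x => Y x i j := by
    refine measurable_matrix_mul (measurable_matrix_mul (fun _ _ => measurable_const)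
      (measurable_cfc_supportIndicator
        (measurable_matrix_mul hMm fun i j => hMm j i) fun x => ?_)) fun _ _ => measurable_const
    simp [IsHermitian, conjTranspose_eq_transpose_of_trivial]
  have hYh : ∀ x, (Y x).IsHermitian := by
    intro x
    have h1 : (cfc supportIndicator (M x * (M x)ᵀ))ᵀ = cfc supportIndicator (M x * (M x)ᵀ) :=
      (cfc_predicate supportIndicator (M x * (M x)ᵀ) : IsSelfAdjoint _)
    simp only [hY, IsHermitian, conjTranspose_eq_transpose_of_trivial, transpose_mul, hB, h1,
      Matrix.mul_assoc]
  have hfc : Continuous fun x => f (max x 0) :=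
    hf.comp_continuous (by fun_prop) fun x => Set.mem_Ici.2 (le_max_right x 0)
  have hFm := measurable_cfc_of_continuous hYm hYh hfc
  refine ⟨fun x => (⨆ N : {N : Matrix (Fin n) (Fin (min k n)) ℝ // Nᵀ * N = 1},
      ENNReal.ofReal (N.1ᵀ * cfc (fun x => f (max x 0)) (Y x) * N.1).trace).toReal,
    (measurable_iSup_trace_compression hFm).ennreal_toReal, ?_⟩
  intro Ω r Q X hQ hX
  have hpos := posSemidef_nystrom (Q := Q) hB hA
  have hfpos : (cfc f (nystrom A Q)).PosSemidef := by
    obtain ⟨U, hU, -, hU'⟩ := exists_orthogonal_eigenvalues hpos.isHermitian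
    rw [hU']
    exact posSemidef_conj_diagonal U fun i => hf0 _ (hpos.eigenvalues_nonneg i)
  have hYQ : Y (fun p => Ω p.1 p.2) = nystrom A Q := (nystrom_eq_cfc hB hA hQ).symm
  have hX0 : 0 ≤ X.trace := by
    obtain ⟨U, hU, t, -, ht, -, rfl⟩ := hX.exists_diagonalization hfpos
    rw [trace_conj hU, trace_diagonal]
    exact Finset.sum_nonneg fun i _ => by split_ifs <;> simp [ht]
  beta_reduce
  rw [hYQ, ← cfc_eq_cfc_max hpos, ← hX.ofReal_trace_eq_iSup hfpos, ENNReal.toReal_ofReal hX0]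

end Measurability

/-! ### Assembling the expectation bound. -/

section Main

variable {n k p s : ℕ}

theorem exists_card_pos {a : Fin n → ℝ} (hanti : Antitone a) (ha : ∀ i, 0 ≤ a i) :
    ∃ m ≤ n, (∀ i : Fin n, (i : ℕ) < m → 0 < a i) ∧ ∀ i : Fin n, m ≤ (i : ℕ) → a i = 0 := by
  classical
  have hex : ∃ m, ∀ i : Fin n, m ≤ (i : ℕ) → a i = 0 :=
    ⟨n, fun i hi => absurd i.2 (not_lt.2 hi)⟩
  refine ⟨Nat.find hex, Nat.find_min' hex fun i hi => absurd i.2 (not_lt.2 hi), fun i hi => ?_,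
    Nat.find_spec hex⟩
  refine lt_of_le_of_ne (ha i) fun h0 => Nat.find_min hex hi fun j hj => ?_
  exact le_antisymm ((hanti (Fin.le_def.2 hj)).trans h0.symm.le) (ha j)

variable {a : Fin n → ℝ} {U : Matrix (Fin n) (Fin n) ℝ} {f : ℝ → ℝ}

theorem posSemidef_cfc {M : Matrix (Fin n) (Fin n) ℝ} (hM : M.PosSemidef)
    (hf0 : ∀ x, 0 ≤ x → 0 ≤ f x) : (cfc f M).PosSemidef := by
  obtain ⟨U, hU, -, hU'⟩ := exists_orthogonal_eigenvalues hM.isHermitian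
  rw [hU']
  exact posSemidef_conj_diagonal U fun i => hf0 _ (hM.eigenvalues_nonneg i)

theorem nuclearNorm_sub_truncated {A B X : Matrix (Fin n) (Fin n) ℝ} (hB : B.PosSemidef)
    (hAB : (A - B).PosSemidef) (hX : IsTruncatedSVD k B X) :
    nuclearNorm (A - X) = A.trace - X.trace ∧ 0 ≤ nuclearNorm (A - X) ∧ 0 ≤ X.trace := by
  have h1 : (A - X).PosSemidef := by
    have := hAB.add (hX.posSemidef_sub hB)
    rwa [sub_add_sub_cancel] at this
  have h2 := nuclearNorm_eq_trace h1
  refine ⟨by rw [h2, trace_sub], h2 ▸ h1.trace_nonneg, ?_⟩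
  obtain ⟨U, hU, t, -, ht, -, rfl⟩ := hX.exists_diagonalization hB
  rw [trace_conj hU, trace_diagonal]
  exact Finset.sum_nonneg fun i _ => by split_ifs <;> simp [ht]

theorem sum_leading_add_sum_trailing (g : Fin n → ℝ) (k : ℕ) :
    (∑ i : Fin n, if (i : ℕ) < k then g i else 0) + (∑ i : Fin n, if k ≤ (i : ℕ) then g i else 0)
      = ∑ i, g i := by
  rw [← Finset.sum_add_distrib]
  refine Finset.sum_congr rfl fun i _ => ?_
  by_cases h : (i : ℕ) < k
  · simp [h, not_le.2 h]
  · simp [h, not_lt.1 h]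

theorem sum_castLE_eq (h : k ≤ n) (g : Fin n → ℝ) :
    ∑ j : Fin k, g (Fin.castLE h j) = ∑ i : Fin n, if (i : ℕ) < k then g i else 0 := by
  rw [← Finset.sum_filter]
  refine Finset.sum_bij (fun j _ => Fin.castLE h j) (fun j _ => ?_)
    (fun _ _ _ _ e => Fin.castLE_injective h e) (fun i hi => ?_) (fun _ _ => rfl)
  · simp
  · exact ⟨⟨i, (Finset.mem_filter.1 hi).2⟩, Finset.mem_univ _, rfl⟩

/-- The entries of `Uᵀ Ω`, as a vector. -/
def rotatedEntries {l : ℕ} (U : Matrix (Fin n) (Fin n) ℝ) (Ω : Matrix (Fin n) (Fin l) ℝ) :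
    Fin n × Fin l → ℝ := fun p => (Uᵀ * Ω) p.1 p.2

theorem topRows_rotatedEntries_mul {l m : ℕ} (h : m ≤ n) (Ω : Matrix (Fin n) (Fin l) ℝ)
    (hx : (topRows h (rotatedEntries U Ω) * (topRows h (rotatedEntries U Ω))ᵀ).det ≠ 0)
    (i j : Fin m) :
    (Uᵀ * Ω * topRightInv h (rotatedEntries U Ω)) (Fin.castLE h i) j = if i = j then 1 else 0 := by
  have := congrFun (congrFun (topRows_mul_topRightInv h hx) i) j
  rw [Matrix.one_apply] at this
  rw [← this, Matrix.mul_apply, Matrix.mul_apply]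
  rfl

section Law

variable {S : Type*} [MeasurableSpace S] {P : Measure S} [IsProbabilityMeasure P] {l : ℕ}
  {W : S → Matrix (Fin n) (Fin l) ℝ}

theorem map_entries_eq_gaussianPi
    (hW_indep : iIndepFun (fun (ij : Fin n × Fin l) (ω : S) => W ω ij.1 ij.2) P)
    (hW_law : ∀ i j, HasLaw (fun ω => W ω i j) (gaussianReal 0 1) P) :
    P.map (fun ω (ij : Fin n × Fin l) => W ω ij.1 ij.2) = gaussianPi (Fin n × Fin l) := by
  have h := (iIndepFun_iff_map_fun_eq_pi_map
    (f := fun (ij : Fin n × Fin l) (ω : S) => W ω ij.1 ij.2)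
    fun ij => (hW_law ij.1 ij.2).aemeasurable).1 hW_indep
  refine h.trans ?_
  congr 1
  ext1 ij
  exact (hW_law ij.1 ij.2).map_eq

theorem map_rotatedEntries (hU : U ∈ orthogonalGroup (Fin n) ℝ)
    (hW_indep : iIndepFun (fun (ij : Fin n × Fin l) (ω : S) => W ω ij.1 ij.2) P)
    (hW_law : ∀ i j, HasLaw (fun ω => W ω i j) (gaussianReal 0 1) P) :
    AEMeasurable (fun ω => rotatedEntries U (W ω)) P ∧
      P.map (fun ω => rotatedEntries U (W ω)) = gaussianPi (Fin n × Fin l) := by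
  have hW : AEMeasurable (fun ω (ij : Fin n × Fin l) => W ω ij.1 ij.2) P :=
    aemeasurable_pi_lambda _ fun ij => (hW_law ij.1 ij.2).aemeasurable
  have hrot := measurePreserving_orthogonal_mul (l := l) hU
  have hcomp : (fun ω => rotatedEntries U (W ω)) =
      (fun (x : Fin n × Fin l → ℝ) (p : Fin n × Fin l) => ∑ i, U i p.1 * x (i, p.2)) ∘
        fun ω (ij : Fin n × Fin l) => W ω ij.1 ij.2 := by
    ext ω p
    simp [rotatedEntries, Matrix.mul_apply]
  rw [hcomp]
  refine ⟨hrot.measurable.comp_aemeasurable hW, ?_⟩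
  rw [← AEMeasurable.map_map_of_aemeasurable hrot.measurable.aemeasurable hW,
    map_entries_eq_gaussianPi hW_indep hW_law, hrot.map_eq]

end Law

/-- The expected error in terms of an orthogonal diagonalization of the matrix. -/
theorem integral_nuclearNorm_le (hp : 2 ≤ p) (hU : U ∈ orthogonalGroup (Fin n) ℝ)
    (hanti : Antitone a) (ha : ∀ i, 0 ≤ a i) {γ : ℝ} (hγ0 : 0 ≤ γ)
    (hγ : ∀ h : k ≤ n, (∀ j : Fin k, 0 < a (Fin.castLE h j)) → ∀ (i : Fin n) (j : Fin k),
      k ≤ (i : ℕ) → a i ≤ γ * a (Fin.castLE h j))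
    {S : Type*} [MeasurableSpace S] (P : Measure S) [IsProbabilityMeasure P]
    (W : S → Matrix (Fin n) (Fin (k + p)) ℝ)
    (hW_indep : iIndepFun (fun (ij : Fin n × Fin (k + p)) (ω : S) => W ω ij.1 ij.2) P)
    (hW_law : ∀ i j, HasLaw (fun ω => W ω i j) (gaussianReal 0 1) P)
    (r : S → ℕ) (Q : (ω : S) → Matrix (Fin n) (Fin (r ω)) ℝ)
    (hQ : ∀ ω, IsOrthonormalBasisOfRange (Q ω) ((U * diagonal a * Uᵀ) ^ s * W ω))
    (hf_cont : ContinuousOn f (Set.Ici 0)) (hf0 : ∀ x, 0 ≤ x → 0 ≤ f x)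
    (hf_mono : OperatorMonotone f) {Y : Matrix (Fin n) (Fin n) ℝ}
    (hY : IsTruncatedSVD k (cfc f (U * diagonal a * Uᵀ)) Y) (X : S → Matrix (Fin n) (Fin n) ℝ)
    (hX : ∀ ω, IsTruncatedSVD k (cfc f (nystrom (U * diagonal a * Uᵀ) (Q ω))) (X ω)) :
    Integrable (fun ω => nuclearNorm (cfc f (U * diagonal a * Uᵀ) - X ω)) P ∧
      ∫ ω, nuclearNorm (cfc f (U * diagonal a * Uᵀ) - X ω) ∂P ≤
        (1 + γ ^ (2 * s) * ((k : ℝ) / ((p : ℝ) - 1))) *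
          nuclearNorm (cfc f (U * diagonal a * Uᵀ) - Y) := by
  set A := U * diagonal a * Uᵀ with hA
  have hconc := hf_mono.concaveOn hf_cont
  have hp' : (2 : ℝ) ≤ p := by exact_mod_cast hp
  have hBT := transpose_conj_diagonal U fun i => √(a i)
  have hBB := conj_sqrt_mul_self hU ha
  have hApos : A.PosSemidef := posSemidef_conj_diagonal U ha
  have hfA : cfc f A = U * diagonal (fun i => f (a i)) * Uᵀ := cfc_conj_diagonal hU a f
  have hfanti : Antitone fun i => f (a i) := fun i j hij =>
    hf_mono.monotoneOn (ha j) (ha i) (hanti hij)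
  have hfa0 : ∀ i, 0 ≤ f (a i) := fun i => hf0 _ (ha i)
  have htrA : (cfc f A).trace = ∑ i, f (a i) := by rw [hfA, trace_conj hU, trace_diagonal]
  have hlead : ∀ Z, IsTruncatedSVD k (cfc f A) Z →
      Z.trace = ∑ i : Fin n, if (i : ℕ) < k then f (a i) else 0 := by
    intro Z hZ
    rw [hfA] at hZ
    exact hZ.trace_eq hU hfanti hfa0
  set τ := ∑ i : Fin n, if k ≤ (i : ℕ) then f (a i) else 0 with hτ
  have hτ0 : 0 ≤ τ := Finset.sum_nonneg fun i _ => by split_ifs <;> simp [hfa0]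
  have hsplit := sum_leading_add_sum_trailing (fun i => f (a i)) k
  have hYτ : nuclearNorm (cfc f A - Y) = τ := by
    have h1 := (nuclearNorm_sub_truncated (A := cfc f A) (posSemidef_cfc hApos hf0)
      (by rw [sub_self]; exact PosSemidef.zero) hY).1
    rw [h1, htrA, hlead Y hY, ← hsplit]
    ring
  have hnys : ∀ ω, (nystrom A (Q ω)).PosSemidef := fun ω => posSemidef_nystrom hBT hBB
  have hXprop : ∀ ω, nuclearNorm (cfc f A - X ω) = (cfc f A).trace - (X ω).trace ∧
      0 ≤ nuclearNorm (cfc f A - X ω) ∧ 0 ≤ (X ω).trace := fun ω =>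
    nuclearNorm_sub_truncated (posSemidef_cfc (hnys ω) hf0)
      (hf_mono n _ _ (hnys ω) (posSemidef_sub_nystrom hBT hBB)) (hX ω)
  obtain ⟨Φ, hΦm, hΦ⟩ := exists_measurable_trace hf_cont hf0 hBT hBB s k (k + p)
  have hWm : AEMeasurable (fun ω (ij : Fin n × Fin (k + p)) => W ω ij.1 ij.2) P :=
    aemeasurable_pi_lambda _ fun ij => (hW_law ij.1 ij.2).aemeasurable
  have hmeas : AEStronglyMeasurable (fun ω => nuclearNorm (cfc f A - X ω)) P := by
    have : (fun ω => nuclearNorm (cfc f A - X ω)) =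
        fun ω => (cfc f A).trace - Φ fun ij => W ω ij.1 ij.2 := by
      ext ω
      rw [(hXprop ω).1, hΦ (W ω) (r ω) (Q ω) (X ω) (hQ ω) (hX ω)]
    rw [this]
    exact ((hΦm.comp_aemeasurable hWm).const_sub _).aestronglyMeasurable
  have hint : Integrable (fun ω => nuclearNorm (cfc f A - X ω)) P := by
    -- The error is tr f(A) - tr X with tr X ≥ 0, so it is bounded by a constant.
    refine Integrable.of_bound hmeas (cfc f A).trace (ae_of_all _ fun ω => ?_)
    obtain ⟨h1, h2, h3⟩ := hXprop ω
    rw [Real.norm_eq_abs, abs_of_nonneg h2, h1]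
    linarith
  refine ⟨hint, ?_⟩
  rw [hYτ]
  obtain ⟨hrm, hrlaw⟩ := map_rotatedEntries hU hW_indep hW_law
  by_cases hcase : ∃ h : k ≤ n, ∀ j : Fin k, 0 < a (Fin.castLE h j)
  · obtain ⟨h, hpos⟩ := hcase
    have hae : ∀ᵐ ω ∂P, (topRows h (rotatedEntries U (W ω)) *
        (topRows h (rotatedEntries U (W ω)))ᵀ).det ≠ 0 := by
      have := ae_det_gram_ne_zero (n := n) (l := k + p) h (by omega)
      rw [← hrlaw] at this
      exact ae_of_ae_map hrm this
    set F : Fin n → Fin k → (Fin n × Fin (k + p) → ℝ) → ℝ := fun i j x =>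
      (∑ y, x (i, y) * topRightInv h x y j) ^ 2 with hF
    have hFm : ∀ i j, Measurable (F i j) := by
      intro i j
      refine Measurable.pow_const ?_ 2
      exact Finset.measurable_sum _ fun y _ =>
        (measurable_pi_apply _).mul (measurable_topRightInv h y j)
    have hbound : ∀ᵐ ω ∂P, nuclearNorm (cfc f A - X ω) ≤ τ + γ ^ (2 * s) *
        ∑ j : Fin k, ∑ i : Fin n, if k ≤ (i : ℕ) then
          f (a i) * F i j (rotatedEntries U (W ω)) else 0 := by
      filter_upwards [hae] with ω hω
      have h1 := sum_leading_le_trace_add hconc hf0 hf_mono h hanti ha hpos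
        (fun i j hi => hγ h hpos i j hi) hU (topRows_rotatedEntries_mul h (W ω) hω) (hQ ω) (hX ω)
      rw [sum_castLE_eq h fun i => f (a i)] at h1
      have h2 : ∀ (i : Fin n) (j : Fin k),
          (Uᵀ * W ω * topRightInv h (rotatedEntries U (W ω))) i j ^ 2
            = F i j (rotatedEntries U (W ω)) := fun i j => rfl
      simp only [h2] at h1
      rw [(hXprop ω).1, htrA, ← hsplit]
      linarith
    have hFint : ∀ (i : Fin n) (j : Fin k), k ≤ (i : ℕ) →
        ∫⁻ ω, ENNReal.ofReal (F i j (rotatedEntries U (W ω))) ∂P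
          ≤ ENNReal.ofReal (1 / ((p : ℝ) - 1)) := by
      intro i j hi
      -- A row of length k + p has p + 1 dimensions orthogonal to the k - 1 other top rows, and (p +
      -- 1) - 2 = p - 1.
      have h1 := lintegral_mul_topRightInv_sq_le (l := k + p) (d := p + 1) h hi j (by omega)
        (by omega)
      rw [← hrlaw, lintegral_map' (hFm i j).ennreal_ofReal.aemeasurable hrm] at h1
      have h2 : ((p + 1 : ℕ) : ℝ) - 2 = (p : ℝ) - 1 := by push_cast; ring
      rwa [h2] at h1
    have hFintegrable : ∀ (i : Fin n) (j : Fin k), k ≤ (i : ℕ) →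
        Integrable (fun ω => F i j (rotatedEntries U (W ω))) P ∧
          ∫ ω, F i j (rotatedEntries U (W ω)) ∂P ≤ 1 / ((p : ℝ) - 1) := by
      intro i j hi
      have hm : AEStronglyMeasurable (fun ω => F i j (rotatedEntries U (W ω))) P :=
        ((hFm i j).comp_aemeasurable hrm).aestronglyMeasurable
      have h0 : 0 ≤ᵐ[P] fun ω => F i j (rotatedEntries U (W ω)) :=
        ae_of_all _ fun ω => sq_nonneg _
      constructor
      · exact (lintegral_ofReal_ne_top_iff_integrable hm h0).1
          ((hFint i j hi).trans_lt ENNReal.ofReal_lt_top).ne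
      · rw [integral_eq_lintegral_of_nonneg_ae h0 hm]
        refine ENNReal.toReal_le_of_le_ofReal ?_ (hFint i j hi)
        exact div_nonneg zero_le_one (by linarith)
    have hTint : ∀ (i : Fin n) (j : Fin k), Integrable (fun ω => if k ≤ (i : ℕ) then
        f (a i) * F i j (rotatedEntries U (W ω)) else 0) P := by
      intro i j
      split_ifs with hi
      · exact (hFintegrable i j hi).1.const_mul _
      · exact integrable_zero _ _ _
    have hsumint : Integrable (fun ω => ∑ j : Fin k, ∑ i : Fin n, if k ≤ (i : ℕ) then
        f (a i) * F i j (rotatedEntries U (W ω)) else 0) P :=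
      integrable_finsetSum _ fun j _ => integrable_finsetSum _ fun i _ => hTint i j
    calc ∫ ω, nuclearNorm (cfc f A - X ω) ∂P
        ≤ ∫ ω, (τ + γ ^ (2 * s) * ∑ j : Fin k, ∑ i : Fin n, if k ≤ (i : ℕ) then
          f (a i) * F i j (rotatedEntries U (W ω)) else 0) ∂P :=
          integral_mono_ae hint ((integrable_const _).add (hsumint.const_mul _)) hbound
      _ = τ + γ ^ (2 * s) * ∑ j : Fin k, ∑ i : Fin n, ∫ ω, (if k ≤ (i : ℕ) then
          f (a i) * F i j (rotatedEntries U (W ω)) else 0) ∂P := by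
          rw [integral_add (integrable_const _) (hsumint.const_mul _), integral_const,
            integral_const_mul, integral_finsetSum _ fun j _ =>
              integrable_finsetSum _ fun i _ => hTint i j]
          simp only [probReal_univ, one_smul]
          congr 2
          exact Finset.sum_congr rfl fun j _ => integral_finsetSum _ fun i _ => hTint i j
      _ ≤ τ + γ ^ (2 * s) * ∑ _j : Fin k, τ * (1 / ((p : ℝ) - 1)) := by
          gcongr with j
          rw [hτ, Finset.sum_mul]
          refine Finset.sum_le_sum fun i _ => ?_
          split_ifs with hi
          · rw [integral_const_mul]
            exact mul_le_mul_of_nonneg_left (hFintegrable i j hi).2 (hfa0 i)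
          · simp
      _ = (1 + γ ^ (2 * s) * ((k : ℝ) / ((p : ℝ) - 1))) * τ := by
          rw [Finset.sum_const, Finset.card_univ, Fintype.card_fin, nsmul_eq_mul]
          ring
  -- Fewer than `k` positive eigenvalues, which includes k > n: the sketch is almost surely exact
  -- and the error is τ.
  · obtain ⟨m, hmn, hmpos, hmzero⟩ := exists_card_pos hanti ha
    have hmk : m < k := by
      by_contra hcon
      have hkm : k ≤ m := not_lt.1 hcon
      exact hcase ⟨hkm.trans hmn, fun j => hmpos _ (j.2.trans_le hkm)⟩
    have hae : ∀ᵐ ω ∂P, (topRows hmn (rotatedEntries U (W ω)) *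
        (topRows hmn (rotatedEntries U (W ω)))ᵀ).det ≠ 0 := by
      have := ae_det_gram_ne_zero (n := n) (l := k + p) hmn (by omega)
      rw [← hrlaw] at this
      exact ae_of_ae_map hrm this
    have heq : ∀ᵐ ω ∂P, nuclearNorm (cfc f A - X ω) = τ := by
      filter_upwards [hae] with ω hω
      have h1 := nystrom_eq_self hmn ha (fun j => hmpos _ j.2) hmzero hU
        (topRows_rotatedEntries_mul hmn (W ω) hω) (hQ ω)
      have h2 := hX ω
      rw [← hA] at h1
      rw [h1] at h2
      rw [(hXprop ω).1, htrA, hlead _ h2, ← hsplit]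
      ring
    rw [integral_congr_ae heq]
    simp only [integral_const, probReal_univ, one_smul]
    refine le_mul_of_one_le_left hτ0 ?_
    have : 0 ≤ γ ^ (2 * s) * ((k : ℝ) / ((p : ℝ) - 1)) :=
      mul_nonneg (pow_nonneg hγ0 _) (div_nonneg (Nat.cast_nonneg _) (by linarith))
    linarith

theorem sortedEigenvalue_nonneg {A : Matrix (Fin n) (Fin n) ℝ} (hA : A.IsHermitian)
    (h : ∀ i : Fin n, 0 ≤ sortedEigenvalue hA (i + 1)) (i : ℕ) : 0 ≤ sortedEigenvalue hA i := by
  by_cases hi : 1 ≤ i ∧ i ≤ n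
  · have := h ⟨i - 1, by omega⟩
    rwa [Nat.sub_add_cancel hi.1] at this
  · rw [sortedEigenvalue, dif_neg hi]

end Main

end FunNystrom

theorem mainTheorem10
    {n k p q : ℕ} (hk : 1 ≤ k) (hp : 2 ≤ p) (hq : 1 ≤ q)
    (A : Matrix (Fin n) (Fin n) ℝ) (hA : A.PosSemidef)
    -- the Gaussian random matrix, of size `n × (k + p)`
    {S : Type*} [MeasurableSpace S] (P : Measure S) [IsProbabilityMeasure P]
    (W : S → Matrix (Fin n) (Fin (k + p)) ℝ)
    (hW_indep : iIndepFun (fun (ij : Fin n × Fin (k + p)) (ω : S) => W ω ij.1 ij.2) P)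
    (hW_law : ∀ i j, HasLaw (fun ω => W ω i j) (gaussianReal 0 1) P)
    -- an orthonormal basis of the range of `A ^ (q - 1) * W`; its size may depend on the outcome
    (r : S → ℕ) (Q : (ω : S) → Matrix (Fin n) (Fin (r ω)) ℝ)
    (hQ : ∀ ω, FunNystrom.IsOrthonormalBasisOfRange (Q ω) (A ^ (q - 1) * W ω))
    (f : ℝ → ℝ) (hf_cont : ContinuousOn f (Set.Ici 0)) (hf_nonneg : ∀ x, 0 ≤ x → 0 ≤ f x)
    (hf_mono : FunNystrom.OperatorMonotone f)
    -- any choice of the best rank-`k` approximations of `f(A)` and of `f` of the Nyström matrix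
    (Y : Matrix (Fin n) (Fin n) ℝ) (hY : FunNystrom.IsTruncatedSVD k (cfc f A) Y)
    (X : S → Matrix (Fin n) (Fin n) ℝ)
    (hX : ∀ ω, FunNystrom.IsTruncatedSVD k (cfc f (FunNystrom.nystrom A (Q ω))) (X ω)) :
    Integrable (fun ω => FunNystrom.nuclearNorm (cfc f A - X ω)) P ∧
      ∫ ω, FunNystrom.nuclearNorm (cfc f A - X ω) ∂P ≤
        (1 + (FunNystrom.sortedEigenvalue hA.isHermitian (k + 1) /
                FunNystrom.sortedEigenvalue hA.isHermitian k) ^ (2 * (q - 1)) *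
            ((k : ℝ) / ((p : ℝ) - 1))) *
          FunNystrom.nuclearNorm (cfc f A - Y) := by
  obtain ⟨U, hU, a, hanti, hAe, hsort⟩ :=
    FunNystrom.exists_orthogonal_sortedEigenvalue hA.isHermitian
  have ha : ∀ i, 0 ≤ a i := FunNystrom.nonneg_of_posSemidef_conj_diagonal hU (hAe ▸ hA)
  have hsort0 := FunNystrom.sortedEigenvalue_nonneg hA.isHermitian fun i => by
    rw [hsort]; exact ha i
  have hγ0 := div_nonneg (hsort0 (k + 1)) (hsort0 k)
  have hγ : ∀ h : k ≤ n, (∀ j : Fin k, 0 < a (Fin.castLE h j)) → ∀ (i : Fin n) (j : Fin k),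
      k ≤ (i : ℕ) → a i ≤ FunNystrom.sortedEigenvalue hA.isHermitian (k + 1) /
        FunNystrom.sortedEigenvalue hA.isHermitian k * a (Fin.castLE h j) := by
    intro h hpos i j hi
    have hkn : k < n := hi.trans_lt i.2
    have h1 := hsort ⟨k, hkn⟩
    have h2 := hsort ⟨k - 1, by omega⟩
    simp only [Nat.sub_add_cancel hk] at h1 h2
    rw [h1, h2]
    have hpos' : 0 < a ⟨k - 1, by omega⟩ := hpos ⟨k - 1, by omega⟩
    have h3 : a i ≤ a ⟨k, hkn⟩ := hanti (Fin.le_def.2 hi)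
    have h4 : a ⟨k - 1, by omega⟩ ≤ a (Fin.castLE h j) := hanti (Fin.le_def.2 (by
      have := j.2
      simp only [Fin.val_castLE]
      omega))
    calc a i ≤ a ⟨k, hkn⟩ / a ⟨k - 1, by omega⟩ * a ⟨k - 1, by omega⟩ := by
          rwa [div_mul_cancel₀ _ hpos'.ne']
      _ ≤ _ := mul_le_mul_of_nonneg_left h4 (div_nonneg (ha _) (ha _))
  -- Only nonnegativity and the gap inequality of the ratio are needed; for λ_k = 0 it is 0, since
  -- division by zero gives 0.
  generalize FunNystrom.sortedEigenvalue hA.isHermitian (k + 1) /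
    FunNystrom.sortedEigenvalue hA.isHermitian k = γ at hγ0 hγ ⊢
  clear hsort hsort0
  subst hAe
  exact FunNystrom.integral_nuclearNorm_le hp hU hanti ha hγ0 hγ P W hW_indep hW_law r Q hQ
    hf_cont hf_nonneg hf_mono hY X hX
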